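/- **Theorem.** Let $E=(E^0,E^1,r,s)$ be a finite directed graph without sources (i.e. $r^{-1}(x)\neq\emptyset$ for every $x\in E^0$), let $G$ be a (discrete) group acting on $E$ by graph automorphisms, and let $\varphi:G\times E^1\to G$ be a 1-cocycle, $\varphi(gh,a)=\varphi(g,ha)\,\varphi(h,a)$, such that $\varphi(g,a)\cdot x=g\cdot x$ for all $g\in G$, $a\in E^1$, $x\in E^0$. Let $R$ be any unital commutative ring. *Paths.* A finite path is a vertex $x$ (length $0$, with range and source $x$) or a word $\alpha=a_1\cdots a_n$ of edges with $s(a_i)=r(a_{i+1})$; its range is $r(a_1)$ and its source is $d(\alpha)=s(a_n)$. Let $E^*$ be the set of finite paths and $E^\infty$ the set of infinite paths $a_1a_2\cdots$, and let $Z(\gamma)\subseteq E^\infty$ be the set of infinite paths that begin with $\gamma\in E^*$. The action and the cocycle extend to paths by $g(a\alpha)=(ga)(\varphi(g,a)\alpha)$, $\varphi(g,a\alpha)=\varphi(\varphi(g,a),\alpha)$ and $\varphi(g,x)=g$ for $x\in E^0$. *Groupoid.* Let $\mathcal S_{G,E}=\{(\alpha,g,\beta):\alpha,\beta\in E^*,\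 g\in G,\ d(\alpha)=g\,d(\beta)\}\cup\{0\}$, with product $$(\alpha,g,\beta)(\gamma,h,\delta)=\begin{cases}(\alpha\,(g\varepsilon),\ \varphi(g,\varepsilon)h,\ \delta)&\text{if }\gamma=\beta\varepsilon,\\ (\alpha,\ g\,\varphi(h^{-1},\varepsilon)^{-1},\ \delta\,(h^{-1}\varepsilon))&\text{if }\beta=\gamma\varepsilon,\\ 0&\text{otherwise,}\end{cases}$$ and $(\alpha,g,\beta)^*=(\beta,g^{-1},\alpha)$. It acts on $E^\infty$ by $(\alpha,g,\beta)\cdot\beta\xi=\alpha(g\xi)$. Let $\mathcal G_{(G,E)}$ be its groupoid of germs $[\alpha,g,\beta;\eta]$, $\eta\in Z(\beta)$, where $[s;\eta]=[t;\mu]$ iff $\eta=\mu$ and there is an idempotent $e\neq0$ of $\mathcal S_{G,E}$ with $e\cdot\eta=\eta$ and $se=te$. The germ $[s;\eta]$ has source $\eta$ and range $s\cdot\eta$, and $[s;t\cdot\eta][t;\eta]=[st;\eta]$, $[s;\eta]^{-1}=[s^*;s\cdot\eta]$. Its topology has as a basis the sets $\Theta((\alpha,g,\beta),Z(\gamma))$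 of all germs $[\alpha,g,\beta;\xi]$ with $\xi\in Z(\gamma)\cap Z(\beta)$. Let $A_R(\mathcal G_{(G,E)})$ be its Steinberg algebra, that is, the $R$-linear span, in the functions $\mathcal G_{(G,E)}\to R$, of the characteristic functions of compact open bisections, with the convolution product. (If $\mathcal G_{(G,E)}$ is Hausdorff, this is the algebra of all locally constant, compactly supported functions.) *Algebra.* Let $\mathcal O^{\mathrm{alg}}_{(G,E)}(R)$ be the universal unital $R$-algebra with generators $p_x$ ($x\in E^0$), $s_a,s_a^*$ ($a\in E^1$), $u_g$ ($g\in G$) and relations 1. $p_xp_y=\delta_{x,y}p_x$ and $\sum_{x\in E^0}p_x=1$; $\;p_{r(a)}s_a=s_a=s_ap_{s(a)}$ and $p_{s(a)}s_a^*=s_a^*=s_a^*p_{r(a)}$; $\;s_a^*s_b=\delta_{a,b}\,p_{s(a)}$; $\;p_x=\sum_{r(a)=x}s_as_a^*$; 2. $u_1=1$ and $u_{gh}=u_gu_h$; 3. $u_gs_a=s_{ga}u_{\varphi(g,a)}$ and $s_a^*u_{g^{-1}}=u_{\varphi(g,a)^{-1}}s_{ga}^*$; 4. $u_gp_x=p_{gx}u_g$.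 For $\alpha=a_1\cdots a_n$ with $n\geq1$ put $s_\alpha=s_{a_1}\cdots s_{a_n}$ and $s_\alpha^*=s_{a_n}^*\cdots s_{a_1}^*$; for a vertex $x$ put $s_x=s_x^*=p_x$. Then there is an isomorphism of $R$-algebras $\phi:A_R(\mathcal G_{(G,E)})\to\mathcal O^{\mathrm{alg}}_{(G,E)}(R)$ such that $\phi\bigl(1_{\Theta((\alpha,g,\beta),Z(\beta))}\bigr)=s_\alpha u_gs_\beta^*$ for all $\alpha,\beta\in E^*$ and $g\in G$ with $d(\alpha)=g\,d(\beta)$. -/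

import Mathlib

namespace ExelPardo

open CategoryTheory Filter

/-- The data of a triple `(G, E, φ)`: a directed graph `E` without sources, with vertex set `V`,
edge set `A`, range `r` and source `s`; the group `G` acts on `E` by graph automorphisms, and
`φ` is a one-cocycle for the action on edges that is compatible with the action on vertices.
(The finiteness of `V` and `A` is imposed by type class arguments where it is used.) -/
structure GraphTriple (G V A : Type*) [Group G] [MulAction G V] [MulAction G A] where
  r : A → V
  s : A → V
  no_sources : ∀ x : V, ∃ a : A, r a = x
  r_smul : ∀ (g : G) (a : A), r (g • a) = g • r a
  s_smul : ∀ (g : G) (a : A), s (g • a) = g • s a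
  φ : G → A → G
  φ_mul : ∀ (g h : G) (a : A), φ (g * h) a = φ g (h • a) * φ h a
  φ_smul : ∀ (g : G) (a : A) (x : V), φ g a • x = g • x

variable {G V A : Type*} [Group G] [MulAction G V] [MulAction G A]

namespace GraphTriple

variable (T : GraphTriple G V A)

/-! ### Finite paths -/

/-- `T.IsPath x [a₁, …, aₙ]`: the edges satisfy `r a₁ = x` and `s aᵢ = r aᵢ₊₁`. -/
def IsPath : V → List A → Prop
  | _, [] => True
  | x, a :: l => T.r a = x ∧ IsPath (T.s a) l

/-- The source of the last edge of the list, or `x` if the list is empty. -/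
def endVertex : V → List A → V
  | x, [] => x
  | _, a :: l => endVertex (T.s a) l

/-- The action of `g` on (lists of edges of) finite paths, `g (a l) = (g a) (φ(g, a) l)`. -/
def act : G → List A → List A
  | _, [] => []
  | g, a :: l => (g • a) :: act (T.φ g a) l

/-- The extension of the cocycle to finite paths, `φ(g, a l) = φ(φ(g, a), l)`, with
`φ(g, x) = g` on vertices. -/
def coc : G → List A → G
  | g, [] => g
  | g, a :: l => coc (T.φ g a) l

variable {T}

theorem isPath_append {x : V} {l m : List A} :
    T.IsPath x (l ++ m) ↔ T.IsPath x l ∧ T.IsPath (T.endVertex x l) m := by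
  induction l generalizing x with
  | nil => simp [IsPath, endVertex]
  | cons a l ih => simp [IsPath, endVertex, ih, and_assoc]

theorem endVertex_append {x : V} {l m : List A} :
    T.endVertex x (l ++ m) = T.endVertex (T.endVertex x l) m := by
  induction l generalizing x with
  | nil => simp [endVertex]
  | cons a l ih => simp [endVertex, ih]

theorem φ_one (a : A) : T.φ 1 a = 1 := by
  have := T.φ_mul 1 1 a
  simpa using this

@[simp] theorem act_nil (g : G) : T.act g [] = [] := rfl
@[simp] theorem coc_nil (g : G) : T.coc g [] = g := rfl

@[simp] theorem length_act (g : G) (l : List A) : (T.act g l).length = l.length := by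
  induction l generalizing g with
  | nil => rfl
  | cons a l ih => simp [act, ih]

theorem act_append (g : G) (l m : List A) :
    T.act g (l ++ m) = T.act g l ++ T.act (T.coc g l) m := by
  induction l generalizing g with
  | nil => rfl
  | cons a l ih => simp [act, coc, ih]

theorem coc_append (g : G) (l m : List A) :
    T.coc g (l ++ m) = T.coc (T.coc g l) m := by
  induction l generalizing g with
  | nil => rfl
  | cons a l ih => simp [coc, ih]

theorem act_mul (g h : G) (l : List A) : T.act (g * h) l = T.act g (T.act h l) := by
  induction l generalizing g h with
  | nil => rfl
  | cons a l ih => simp [act, ih, T.φ_mul, mul_smul]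

theorem coc_mul (g h : G) (l : List A) :
    T.coc (g * h) l = T.coc g (T.act h l) * T.coc h l := by
  induction l generalizing g h with
  | nil => rfl
  | cons a l ih => simp [act, coc, ih, T.φ_mul]

@[simp] theorem act_one (l : List A) : T.act 1 l = l := by
  induction l with
  | nil => rfl
  | cons a l ih => simp [act, φ_one, ih]

@[simp] theorem coc_one (l : List A) : T.coc 1 l = 1 := by
  induction l with
  | nil => rfl
  | cons a l ih => simp [coc, φ_one, ih]

theorem coc_inv (g : G) (l : List A) : T.coc g⁻¹ (T.act g l) = (T.coc g l)⁻¹ := by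
  have := T.coc_mul g⁻¹ g l
  rw [inv_mul_cancel, coc_one] at this
  exact eq_inv_of_mul_eq_one_left this.symm

theorem coc_inv' (g : G) (l : List A) : T.coc g (T.act g⁻¹ l) = (T.coc g⁻¹ l)⁻¹ := by
  simpa using T.coc_inv g⁻¹ l

theorem act_inv_act (g : G) (l : List A) : T.act g⁻¹ (T.act g l) = l := by
  rw [← act_mul, inv_mul_cancel, act_one]

theorem act_act_inv (g : G) (l : List A) : T.act g (T.act g⁻¹ l) = l := by
  rw [← act_mul, mul_inv_cancel, act_one]

theorem coc_smul (g : G) (l : List A) (x : V) : T.coc g l • x = g • x := by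
  induction l generalizing g with
  | nil => rfl
  | cons a l ih => simp [coc, ih, T.φ_smul]

theorem isPath_act {x : V} {l : List A} (g : G) (h : T.IsPath x l) :
    T.IsPath (g • x) (T.act g l) := by
  induction l generalizing x g with
  | nil => trivial
  | cons a l ih =>
    refine ⟨by rw [T.r_smul, h.1], ?_⟩
    have := ih (T.φ g a) h.2
    rwa [T.φ_smul, ← T.s_smul] at this

theorem endVertex_act (g : G) (x : V) (l : List A) :
    T.endVertex (g • x) (T.act g l) = g • T.endVertex x l := by
  induction l generalizing x g with
  | nil => rfl
  | cons a l ih =>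
    simp only [act, endVertex]
    rw [T.s_smul, ← T.φ_smul g a, ih, T.φ_smul]

theorem IsPath.unique {x y : V} {l : List A} (h : T.IsPath x l) (h' : T.IsPath y l)
    (hl : l ≠ []) : x = y := by
  cases l with
  | nil => exact absurd rfl hl
  | cons a l => exact h.1.symm.trans h'.1

variable (T)

/-- Finite paths in `E`, including the paths of length zero, which are the vertices. -/
@[ext] structure FinPath where
  /-- the range of the path -/
  rng : V
  /-- the edges `a₁, …, aₙ` of the path -/
  edges : List A
  valid : T.IsPath rng edges

/-- The source `d(α)` of a finite path. -/
def FinPath.d {T : GraphTriple G V A} (α : T.FinPath) : V := T.endVertex α.rng α.edges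

/-- The concatenation of `α` with a list of edges that continues it. -/
def FinPath.extend {T : GraphTriple G V A} (α : T.FinPath) (ε : List A)
    (h : T.IsPath α.d ε) : T.FinPath :=
  ⟨α.rng, α.edges ++ ε, isPath_append.2 ⟨α.valid, h⟩⟩

theorem FinPath.d_extend {T : GraphTriple G V A} (α : T.FinPath) (ε : List A)
    (h : T.IsPath α.d ε) : (α.extend ε h).d = T.endVertex α.d ε :=
  endVertex_append

/-! ### The inverse semigroup -/

/-- The nonzero elements `(α, g, β)`, `d(α) = g d(β)`, of the inverse semigroup of `(G, E, φ)`. -/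
@[ext] structure Triple where
  α : T.FinPath
  g : G
  β : T.FinPath
  d_eq : α.d = g • β.d

/-- The inverse semigroup of `(G, E, φ)`: all triples `(α, g, β)` with `d(α) = g d(β)`, together
with a zero element (represented by `none`). -/
def SGE := Option T.Triple

/-- `γ = β ε`: the finite path `β` is an initial segment of `γ`. -/
def FinPath.IsPrefix {T : GraphTriple G V A} (β γ : T.FinPath) : Prop :=
  β.rng = γ.rng ∧ β.edges <+: γ.edges

/-- The list of edges `ε` with `γ = β ε`, if `β` is an initial segment of `γ`. -/
def FinPath.remainder {T : GraphTriple G V A} (β γ : T.FinPath) : List A :=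
  γ.edges.drop β.edges.length

variable {T}

theorem FinPath.IsPrefix.append_remainder {β γ : T.FinPath} (h : β.IsPrefix γ) :
    β.edges ++ β.remainder γ = γ.edges := by
  obtain ⟨ε, hε⟩ := h.2
  simp [FinPath.remainder, ← hε]

theorem FinPath.IsPrefix.isPath {β γ : T.FinPath} (h : β.IsPrefix γ) :
    T.IsPath β.d (β.remainder γ) := by
  have := γ.valid
  rw [← h.append_remainder, isPath_append, ← h.1] at this
  exact this.2

theorem FinPath.IsPrefix.d_eq {β γ : T.FinPath} (h : β.IsPrefix γ) :
    γ.d = T.endVertex β.d (β.remainder γ) := by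
  rw [FinPath.d, ← h.append_remainder, endVertex_append, ← h.1, FinPath.d]

open Classical in
/-- The product of two nonzero elements:
`(α, g, β) (γ, h, δ) = (α (g ε), φ(g, ε) h, δ)` if `γ = β ε`,
`(α, g, β) (γ, h, δ) = (α, g φ(h⁻¹, ε)⁻¹, δ (h⁻¹ ε))` if `β = γ ε`,
and zero (that is, `none`) otherwise. -/
noncomputable def Triple.mul (s t : T.Triple) : Option T.Triple :=
  if h : s.β.IsPrefix t.α then
    some
      { α := s.α.extend (T.act s.g (s.β.remainder t.α)) (by
          rw [s.d_eq]; exact isPath_act _ h.isPath)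
        g := T.coc s.g (s.β.remainder t.α) * t.g
        β := t.β
        d_eq := by
          rw [FinPath.d_extend, s.d_eq, endVertex_act, mul_smul, coc_smul, ← t.d_eq, h.d_eq] }
  else if h : t.α.IsPrefix s.β then
    some
      { α := s.α
        g := s.g * (T.coc t.g⁻¹ (t.α.remainder s.β))⁻¹
        β := t.β.extend (T.act t.g⁻¹ (t.α.remainder s.β)) (by
          have : t.β.d = t.g⁻¹ • t.α.d := by rw [t.d_eq, inv_smul_smul]
          rw [this]; exact isPath_act _ h.isPath)
        d_eq := by
          have : t.β.d = t.g⁻¹ • t.α.d := by rw [t.d_eq, inv_smul_smul]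
          rw [FinPath.d_extend, s.d_eq, this, endVertex_act, mul_smul, h.d_eq,
            ← coc_smul t.g⁻¹ (t.α.remainder s.β), inv_smul_smul] }
  else none

/-- `(α, g, β)* = (β, g⁻¹, α)`. -/
def Triple.star (s : T.Triple) : T.Triple :=
  ⟨s.β, s.g⁻¹, s.α, by rw [s.d_eq, inv_smul_smul]⟩

instance : Zero (SGE T) := ⟨(none : Option T.Triple)⟩

/-- The multiplication of the inverse semigroup, in which `0` is absorbing. -/
noncomputable instance : Mul (SGE T) :=
  ⟨fun s t => Option.bind s fun s' => Option.bind t fun t' => s'.mul t'⟩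

/-- A triple, as a nonzero element of the inverse semigroup. -/
def Triple.toSGE (s : T.Triple) : SGE T := some s

theorem toSGE_mul (s t : T.Triple) : s.toSGE * t.toSGE = s.mul t := rfl

variable (T)

/-! ### Infinite paths -/

/-- The space of infinite paths `a₀ a₁ a₂ …`, with `s aₙ = r aₙ₊₁`. -/
@[ext] structure InfPath where
  seq : Stream' A
  valid : ∀ n, T.s (seq n) = T.r (seq (n + 1))

/-- The action of `g` on infinite paths: the `n`-th edge of `g ξ` is `φ(g, ξ|ₙ) ξₙ`. -/
def actInf (g : G) (ξ : Stream' A) : Stream' A := fun n => T.coc g (ξ.take n) • ξ n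

variable {T}

/-- The range of an infinite path. -/
def InfPath.rng (ξ : T.InfPath) : V := T.r (ξ.seq 0)

/-- The cylinder `Z(γ)` of all infinite paths `γ ξ`. -/
def cylinder (γ : T.FinPath) : Set T.InfPath :=
  {η | ∃ ξ : T.InfPath, γ.d = ξ.rng ∧ η.seq = γ.edges ++ₛ ξ.seq}

/-- The action of the inverse semigroup on infinite paths, as a relation: `s.Maps η μ` says that
`η = β ξ` for some infinite path `ξ`, and `(α, g, β) · η = α (g ξ) = μ`. -/
def Triple.Maps (s : T.Triple) (η μ : T.InfPath) : Prop :=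
  ∃ ξ : T.InfPath, s.β.d = ξ.rng ∧ η.seq = s.β.edges ++ₛ ξ.seq ∧
    μ.seq = s.α.edges ++ₛ T.actInf s.g ξ.seq

/-- The germs of `s` and `t` at `η` agree: there is an idempotent `e ≠ 0` with `e · η = η` and
`s e = t e`. -/
def GermRel (η : T.InfPath) (s t : T.Triple) : Prop :=
  ∃ e : T.Triple, e.toSGE * e.toSGE = e.toSGE ∧ e.Maps η η ∧
    s.toSGE * e.toSGE = t.toSGE * e.toSGE

/-! ### Facts on infinite paths -/

theorem stream_take_append (l : List A) (ξ : Stream' A) (m : ℕ) :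
    (l ++ₛ ξ).take (l.length + m) = l ++ ξ.take m := by
  induction l with
  | nil => simp
  | cons a l ih =>
    rw [List.length_cons, Nat.add_right_comm, Stream'.cons_append_stream, Stream'.take_succ_cons,
      ih, List.cons_append]

theorem stream_append_inj {l m : List A} {ξ ζ : Stream' A} (h : l ++ₛ ξ = m ++ₛ ζ)
    (hl : l.length = m.length) : l = m ∧ ξ = ζ := by
  have h1 := congrArg (Stream'.take (l.length + 0)) h
  have h2 := congrArg (Stream'.drop l.length) h
  rw [stream_take_append] at h1
  rw [Stream'.drop_append_stream] at h2
  rw [hl] at h1 h2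
  rw [stream_take_append] at h1
  rw [Stream'.drop_append_stream] at h2
  exact ⟨by simpa using h1, h2⟩

theorem stream_append_left_cancel {l : List A} {ξ ζ : Stream' A} (h : l ++ₛ ξ = l ++ₛ ζ) :
    ξ = ζ := (stream_append_inj h rfl).2

theorem take_actInf (g : G) (ξ : Stream' A) (n : ℕ) :
    (T.actInf g ξ).take n = T.act g (ξ.take n) := by
  induction n with
  | zero => simp
  | succ n ih => rw [Stream'.take_succ', Stream'.take_succ', act_append, ih]; rfl

theorem actInf_append (g : G) (l : List A) (ξ : Stream' A) :
    T.actInf g (l ++ₛ ξ) = T.act g l ++ₛ T.actInf (T.coc g l) ξ := by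
  refine Stream'.take_theorem _ _ fun n => ?_
  have key : (T.actInf g (l ++ₛ ξ)).take (l.length + n) =
      (T.act g l ++ₛ T.actInf (T.coc g l) ξ).take (l.length + n) := by
    rw [take_actInf, stream_take_append, act_append, ← length_act (T := T) g l,
      stream_take_append, take_actInf]
  have := congrArg (List.take n) key
  simpa [Stream'.take_take] using this

theorem actInf_mul (g h : G) (ξ : Stream' A) :
    T.actInf (g * h) ξ = T.actInf g (T.actInf h ξ) := by
  refine Stream'.take_theorem _ _ fun n => ?_
  rw [take_actInf, take_actInf, take_actInf, act_mul]

@[simp] theorem actInf_one (ξ : Stream' A) : T.actInf 1 ξ = ξ := by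
  refine Stream'.take_theorem _ _ fun n => ?_
  rw [take_actInf, act_one]

/-- The infinite path `g ξ`. -/
def InfPath.smul (g : G) (ξ : T.InfPath) : T.InfPath where
  seq := T.actInf g ξ.seq
  valid n := by
    have h := ξ.valid n
    change T.s (T.coc g (ξ.seq.take n) • ξ.seq n) =
      T.r (T.coc g (ξ.seq.take (n + 1)) • ξ.seq (n + 1))
    rw [T.s_smul, T.r_smul, coc_smul, coc_smul, h]

theorem InfPath.rng_smul (g : G) (ξ : T.InfPath) : (ξ.smul g).rng = g • ξ.rng :=
  T.r_smul g (ξ.seq 0)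

theorem InfPath.isPath_take (ξ : T.InfPath) (n : ℕ) :
    T.IsPath ξ.rng (ξ.seq.take n) ∧ T.endVertex ξ.rng (ξ.seq.take n) = T.r (ξ.seq n) := by
  induction n with
  | zero => exact ⟨trivial, rfl⟩
  | succ n ih =>
    rw [Stream'.take_succ', isPath_append, endVertex_append]
    exact ⟨⟨ih.1, ih.2.symm, trivial⟩, ξ.valid n⟩

/-- The initial segment of length `n` of an infinite path. -/
def InfPath.initSeg (ξ : T.InfPath) (n : ℕ) : T.FinPath :=
  ⟨ξ.rng, ξ.seq.take n, (ξ.isPath_take n).1⟩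

/-- The infinite path that remains after the first `n` edges are removed. -/
def InfPath.tail (ξ : T.InfPath) (n : ℕ) : T.InfPath :=
  ⟨ξ.seq.drop n, fun k => by
    change T.s (ξ.seq (k + n)) = T.r (ξ.seq (k + 1 + n))
    rw [ξ.valid, Nat.add_right_comm]⟩

theorem InfPath.d_initSeg (ξ : T.InfPath) (n : ℕ) : (ξ.initSeg n).d = (ξ.tail n).rng := by
  refine (ξ.isPath_take n).2.trans ?_
  change _ = T.r (ξ.seq (0 + n))
  rw [Nat.zero_add]

theorem valid_append {l : List A} {x : V} {ξ : T.InfPath} (hl : T.IsPath x l)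
    (h : T.endVertex x l = ξ.rng) :
    (∀ n, T.s ((l ++ₛ ξ.seq) n) = T.r ((l ++ₛ ξ.seq) (n + 1))) ∧ T.r ((l ++ₛ ξ.seq) 0) = x := by
  induction l generalizing x with
  | nil => exact ⟨ξ.valid, h.symm⟩
  | cons a l ih =>
    obtain ⟨h1, h2⟩ := ih hl.2 h
    refine ⟨fun n => ?_, hl.1⟩
    cases n with
    | zero => exact h2.symm
    | succ n => exact h1 n

/-- The concatenation `γ ξ` of a finite and an infinite path. -/
def FinPath.concat (γ : T.FinPath) (ξ : T.InfPath) (h : γ.d = ξ.rng) : T.InfPath :=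
  ⟨γ.edges ++ₛ ξ.seq, (valid_append γ.valid h).1⟩

theorem rng_of_append {γ : T.FinPath} {ξ η : T.InfPath} (h : γ.d = ξ.rng)
    (h' : η.seq = γ.edges ++ₛ ξ.seq) : η.rng = γ.rng := by
  rw [InfPath.rng, h']; exact (valid_append γ.valid h).2

theorem mem_cylinder {γ : T.FinPath} {η : T.InfPath} :
    η ∈ cylinder γ ↔ η.rng = γ.rng ∧ η.seq.take γ.edges.length = γ.edges := by
  constructor
  · rintro ⟨ξ, h, h'⟩
    refine ⟨rng_of_append h h', ?_⟩
    rw [h']; simpa using stream_take_append γ.edges ξ.seq 0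
  · rintro ⟨h, h'⟩
    refine ⟨η.tail γ.edges.length, ?_, ?_⟩
    · rw [← InfPath.d_initSeg, FinPath.d, FinPath.d]
      simp only [InfPath.initSeg]
      rw [h', h]
    · change η.seq = γ.edges ++ₛ Stream'.drop γ.edges.length η.seq
      have := Stream'.append_take_drop γ.edges.length η.seq
      rw [h'] at this
      exact this.symm

theorem Triple.Maps.mem_cylinder {s : T.Triple} {η μ : T.InfPath} (h : s.Maps η μ) :
    η ∈ cylinder s.β := by
  obtain ⟨ξ, h1, h2, -⟩ := h
  exact ⟨ξ, h1, h2⟩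

theorem Triple.Maps.star {s : T.Triple} {η μ : T.InfPath} (h : s.Maps η μ) :
    s.star.Maps μ η := by
  obtain ⟨ξ, h1, h2, h3⟩ := h
  refine ⟨ξ.smul s.g, ?_, h3, ?_⟩
  · rw [InfPath.rng_smul, ← h1]; exact s.d_eq
  · change η.seq = s.β.edges ++ₛ T.actInf s.g⁻¹ (T.actInf s.g ξ.seq)
    rw [← actInf_mul, inv_mul_cancel, actInf_one, h2]

theorem Triple.Maps.mem_cylinder' {s : T.Triple} {η μ : T.InfPath} (h : s.Maps η μ) :
    μ ∈ cylinder s.α := h.star.mem_cylinder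

theorem Triple.exists_maps {s : T.Triple} {η : T.InfPath} (h : η ∈ cylinder s.β) :
    ∃ μ, s.Maps η μ := by
  obtain ⟨ξ, h1, h2⟩ := h
  exact ⟨s.α.concat (ξ.smul s.g) (by rw [InfPath.rng_smul, ← h1, s.d_eq]), ξ, h1, h2, rfl⟩

theorem Triple.Maps.unique {s : T.Triple} {η μ μ' : T.InfPath} (h : s.Maps η μ)
    (h' : s.Maps η μ') : μ = μ' := by
  obtain ⟨ξ, h1, h2, h3⟩ := h
  obtain ⟨ξ', h1', h2', h3'⟩ := h'
  have : ξ.seq = ξ'.seq := stream_append_left_cancel (h2.symm.trans h2')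
  ext1
  rw [h3, h3', this]

theorem Triple.Maps.inj {s : T.Triple} {η η' μ : T.InfPath} (h : s.Maps η μ)
    (h' : s.Maps η' μ) : η = η' := h.star.unique h'.star

/-! ### Germs -/

/-- The paths and group elements that describe the germ of `s = (α, g, β)` at `η = β ξ`: if
`η|ₙ = β ε`, this is the pair consisting of `α (g ε)` and `φ(g, ε)`. -/
def Triple.lev (s : T.Triple) (η : T.InfPath) (n : ℕ) : List A × G :=
  (s.α.edges ++ T.act s.g ((η.seq.drop s.β.edges.length).take (n - s.β.edges.length)),
    T.coc s.g ((η.seq.drop s.β.edges.length).take (n - s.β.edges.length)))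

theorem Triple.lev_add {s : T.Triple} {η : T.InfPath} {ξ : Stream' A}
    (h : η.seq = s.β.edges ++ₛ ξ) (m : ℕ) :
    s.lev η (s.β.edges.length + m) =
      (s.α.edges ++ T.act s.g (ξ.take m), T.coc s.g (ξ.take m)) := by
  rw [Triple.lev, h, Stream'.drop_append_stream, Nat.add_sub_cancel_left]

theorem Triple.length_lev (s : T.Triple) (η : T.InfPath) (n : ℕ) :
    (s.lev η n).1.length = s.α.edges.length + (n - s.β.edges.length) := by
  simp [Triple.lev]

theorem Triple.tendsto_lev (s : T.Triple) (η : T.InfPath) :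
    Tendsto (fun n => (s.lev η n).1.length) atTop atTop := by
  simp only [Triple.length_lev]
  exact tendsto_atTop_mono (fun n => Nat.le_add_left _ _)
    (tendsto_sub_atTop_nat s.β.edges.length)

theorem Triple.Maps.take_eq {s : T.Triple} {η μ : T.InfPath} (h : s.Maps η μ) :
    ∀ᶠ n in atTop, μ.seq.take (s.lev η n).1.length = (s.lev η n).1 := by
  obtain ⟨ξ, h1, h2, h3⟩ := h
  filter_upwards [eventually_ge_atTop s.β.edges.length] with n hn
  obtain ⟨m, rfl⟩ := Nat.exists_eq_add_of_le hn
  rw [s.lev_add h2, h3]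
  simp only [List.length_append, length_act, Stream'.length_take]
  rw [stream_take_append, take_actInf]

theorem comparable_of_mem {β γ : T.FinPath} {μ : T.InfPath} (h : μ ∈ cylinder β)
    (h' : μ ∈ cylinder γ) : β.IsPrefix γ ∨ γ.IsPrefix β := by
  rw [mem_cylinder] at h h'
  have key : ∀ {β γ : T.FinPath}, μ.rng = β.rng ∧ μ.seq.take β.edges.length = β.edges →
      μ.rng = γ.rng ∧ μ.seq.take γ.edges.length = γ.edges →
      β.edges.length ≤ γ.edges.length → β.IsPrefix γ := by
    intro β γ h h' hl
    refine ⟨h.1.symm.trans h'.1, ?_⟩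
    rw [← h.2, ← h'.2]
    rw [← min_eq_right hl, ← Stream'.take_take]
    exact List.take_prefix _ _
  rcases le_total β.edges.length γ.edges.length with hl | hl
  · exact Or.inl (key h h' hl)
  · exact Or.inr (key h' h hl)

/-- If `t · η = μ` and `s · μ = ζ`, then `s t ≠ 0`, `(s t) · η = ζ`, and the germ of the product
is computed in the expected way. -/
theorem Triple.Maps.mul {s t : T.Triple} {η μ ζ : T.InfPath} (ht : t.Maps η μ)
    (hs : s.Maps μ ζ) :
    ∃ u : T.Triple, s.mul t = some u ∧ u.Maps η ζ ∧
      ∀ᶠ n in atTop, u.lev η n = ((s.lev μ (t.lev η n).1.length).1,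
        (s.lev μ (t.lev η n).1.length).2 * (t.lev η n).2) := by
  have hμs := hs.mem_cylinder
  have hμt := ht.mem_cylinder'
  obtain ⟨ξ, h1, h2, h3⟩ := ht
  obtain ⟨ξ', h1', h2', h3'⟩ := hs
  rw [Triple.mul]
  by_cases h : s.β.IsPrefix t.α
  · rw [dif_pos h]
    refine ⟨_, rfl, ⟨ξ, h1, h2, ?_⟩, ?_⟩
    all_goals
      have e1 : ξ'.seq = s.β.remainder t.α ++ₛ T.actInf t.g ξ.seq := by
        apply stream_append_left_cancel (l := s.β.edges)
        rw [← h2', h3, ← Stream'.append_append_stream, h.append_remainder]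
    · rw [h3', e1, actInf_append, actInf_mul]
      simp [FinPath.extend]
    · filter_upwards [eventually_ge_atTop t.β.edges.length] with n hn
      obtain ⟨m, rfl⟩ := Nat.exists_eq_add_of_le hn
      rw [t.lev_add h2, Triple.lev_add (ξ := ξ.seq) (by exact h2)]
      have e2 : (t.α.edges ++ T.act t.g (ξ.seq.take m)).length =
          s.β.edges.length + ((s.β.remainder t.α).length + m) := by
        rw [← h.append_remainder]; simp
      simp only [e2, s.lev_add h2', e1, stream_take_append, take_actInf]
      simp [FinPath.extend, act_append, coc_append, coc_mul, act_mul]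
  · rw [dif_neg h]
    have h := (comparable_of_mem hμs hμt).resolve_left h
    rw [dif_pos h]
    have e1 : T.actInf t.g ξ.seq = t.α.remainder s.β ++ₛ ξ'.seq := by
      apply stream_append_left_cancel (l := t.α.edges)
      rw [← h3, h2', ← Stream'.append_append_stream, h.append_remainder]
    have e2 : ξ.seq = T.act t.g⁻¹ (t.α.remainder s.β) ++ₛ
        T.actInf (T.coc t.g⁻¹ (t.α.remainder s.β)) ξ'.seq := by
      rw [← actInf_append, ← e1, ← actInf_mul, inv_mul_cancel, actInf_one]
    have e3 : η.seq = (t.β.edges ++ T.act t.g⁻¹ (t.α.remainder s.β)) ++ₛ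
        (ξ'.smul (T.coc t.g⁻¹ (t.α.remainder s.β))).seq := by
      rw [h2, e2, Stream'.append_append_stream]; rfl
    refine ⟨_, rfl, ⟨ξ'.smul (T.coc t.g⁻¹ (t.α.remainder s.β)), ?_, e3, ?_⟩, ?_⟩
    · have : t.β.d = t.g⁻¹ • t.α.d := by rw [t.d_eq, inv_smul_smul]
      rw [FinPath.d_extend, InfPath.rng_smul, this, endVertex_act, ← h.d_eq, coc_smul, h1']
    · rw [h3']
      simp only [InfPath.smul]
      rw [← actInf_mul, inv_mul_cancel_right]
    · filter_upwards [eventually_ge_atTop (t.β.edges.length + (t.α.remainder s.β).length)]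
        with n hn
      obtain ⟨m, rfl⟩ := Nat.exists_eq_add_of_le hn
      have e4 : (t.α.edges ++ T.act t.g (ξ.seq.take ((t.α.remainder s.β).length + m))).length =
          s.β.edges.length + m := by
        rw [← h.append_remainder]; simp [add_assoc]
      have e5 : ξ.seq.take ((t.α.remainder s.β).length + m) =
          T.act t.g⁻¹ (t.α.remainder s.β) ++
            T.act (T.coc t.g⁻¹ (t.α.remainder s.β)) (ξ'.seq.take m) := by
        rw [e2, ← length_act (T := T) t.g⁻¹ (t.α.remainder s.β), stream_take_append, take_actInf]
      have e6 := Triple.lev_add (s := ⟨s.α, s.g * (T.coc t.g⁻¹ (t.α.remainder s.β))⁻¹,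
        t.β.extend (T.act t.g⁻¹ (t.α.remainder s.β)) (by
          have : t.β.d = t.g⁻¹ • t.α.d := by rw [t.d_eq, inv_smul_smul]
          rw [this]; exact isPath_act _ h.isPath), by
          have : t.β.d = t.g⁻¹ • t.α.d := by rw [t.d_eq, inv_smul_smul]
          rw [FinPath.d_extend, s.d_eq, this, endVertex_act, mul_smul, h.d_eq,
            ← coc_smul t.g⁻¹ (t.α.remainder s.β), inv_smul_smul]⟩) e3 m
      have e7 : (t.β.edges ++ T.act t.g⁻¹ (t.α.remainder s.β)).length =
        t.β.edges.length + (t.α.remainder s.β).length := by simp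
      simp only [FinPath.extend, e7] at e6
      simp only [FinPath.extend]
      rw [e6, add_assoc, t.lev_add h2]
      simp only [e4, s.lev_add h2']
      simp only [e5, InfPath.smul, take_actInf, act_mul, act_inv_act, coc_mul, coc_inv, coc_append,
        coc_inv']

theorem idem_eq {e : T.Triple} (h : e.toSGE * e.toSGE = e.toSGE) : e.α = e.β ∧ e.g = 1 := by
  rw [toSGE_mul, Triple.mul] at h
  split_ifs at h with h1 h2
  · have h' := Option.some.inj h
    have ha := congrArg (fun t : T.Triple => t.α.edges.length) h'
    have hg := congrArg (fun t : T.Triple => t.g) h'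
    simp only [FinPath.extend, List.length_append, length_act] at ha hg
    have hε : e.β.remainder e.α = [] := List.eq_nil_of_length_eq_zero (by omega)
    have h3 := h1.append_remainder
    rw [hε, List.append_nil] at h3
    rw [hε, coc_nil] at hg
    exact ⟨FinPath.ext h1.1.symm h3.symm, by simpa using hg⟩
  · have h' := Option.some.inj h
    have ha := congrArg (fun t : T.Triple => t.β.edges.length) h'
    have hg := congrArg (fun t : T.Triple => t.g) h'
    simp only [FinPath.extend, List.length_append, length_act] at ha hg
    have hε : e.α.remainder e.β = [] := List.eq_nil_of_length_eq_zero (by omega)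
    have h3 := h2.append_remainder
    rw [hε, List.append_nil] at h3
    rw [hε, coc_nil] at hg
    exact ⟨FinPath.ext h2.1 h3, by simpa using hg⟩
  · cases h

/-- The idempotent `(γ, 1, γ)`. -/
def idem (γ : T.FinPath) : T.Triple := ⟨γ, 1, γ, (one_smul G _).symm⟩

theorem FinPath.isPrefix_self (γ : T.FinPath) : γ.IsPrefix γ := ⟨rfl, List.prefix_rfl⟩

theorem idem_mul_idem (γ : T.FinPath) : (idem γ).toSGE * (idem γ).toSGE = (idem γ).toSGE := by
  rw [toSGE_mul, Triple.mul]
  have h : (idem γ).β.IsPrefix (idem γ).α := γ.isPrefix_self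
  rw [dif_pos h]
  refine congrArg some (Triple.ext (FinPath.ext rfl ?_) ?_ rfl) <;>
  simp [idem, FinPath.extend, FinPath.remainder]

theorem idem_maps {γ : T.FinPath} {η : T.InfPath} (h : η ∈ cylinder γ) :
    (idem γ).Maps η η := by
  obtain ⟨ξ, h1, h2⟩ := h
  exact ⟨ξ, h1, h2, by rw [h2]; simp [idem]⟩

theorem lev_idem {γ : T.FinPath} {η : T.InfPath} (h : η ∈ cylinder γ) :
    ∀ᶠ n in atTop, (idem γ).lev η n = (η.seq.take n, 1) := by
  obtain ⟨ξ, h1, h2⟩ := h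
  filter_upwards [eventually_ge_atTop γ.edges.length] with n hn
  obtain ⟨m, rfl⟩ := Nat.exists_eq_add_of_le hn
  have := Triple.lev_add (s := idem γ) h2 m
  simp only [idem] at this
  rw [idem, this, h2, stream_take_append]
  simp

theorem InfPath.mem_cylinder_initSeg (η : T.InfPath) (n : ℕ) : η ∈ cylinder (η.initSeg n) := by
  rw [GraphTriple.mem_cylinder]
  exact ⟨rfl, by simp [InfPath.initSeg]⟩

theorem mul_idem_lev {s : T.Triple} {η μ : T.InfPath} (hs : s.Maps η μ) {γ : T.FinPath}
    (h : η ∈ cylinder γ) :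
    ∃ u : T.Triple, s.toSGE * (idem γ).toSGE = u.toSGE ∧ ∀ᶠ n in atTop, u.lev η n = s.lev η n := by
  obtain ⟨u, hu, -, hl⟩ := (idem_maps h).mul hs
  refine ⟨u, hu, ?_⟩
  filter_upwards [hl, lev_idem h] with n h1 h2
  rw [h1, h2]
  simp

theorem mul_idem_initSeg {s : T.Triple} {η μ : T.InfPath} (hs : s.Maps η μ) {n : ℕ}
    (hn : s.β.edges.length ≤ n) :
    ∃ h h', s.toSGE * (idem (η.initSeg n)).toSGE =
      Triple.toSGE ⟨⟨s.α.rng, (s.lev η n).1, h⟩, (s.lev η n).2, η.initSeg n, h'⟩ := by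
  have hp : s.β.IsPrefix (idem (η.initSeg n)).α := by
    refine (comparable_of_mem hs.mem_cylinder (η.mem_cylinder_initSeg n)).elim id fun h => ⟨h.1.symm, ?_⟩
    have h1 := h.2
    have h2 : (η.initSeg n).edges = s.β.edges := h1.eq_of_length_le (by simpa [InfPath.initSeg])
    exact h2 ▸ List.prefix_rfl
  obtain ⟨ξ, h1, h2, h3⟩ := hs
  obtain ⟨m, rfl⟩ := Nat.exists_eq_add_of_le hn
  have hr : s.β.remainder (idem (η.initSeg (s.β.edges.length + m))).α = ξ.seq.take m := by
    simp [FinPath.remainder, idem, InfPath.initSeg, h2, stream_take_append]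
  rw [toSGE_mul, Triple.mul, dif_pos hp]
  have e1 := s.lev_add h2 m
  have key : ∀ (u : T.Triple), u.α.rng = s.α.rng → u.α.edges =
      (s.lev η (s.β.edges.length + m)).1 → u.g = (s.lev η (s.β.edges.length + m)).2 →
      u.β = η.initSeg (s.β.edges.length + m) → ∃ h h', some u =
      Triple.toSGE ⟨⟨s.α.rng, (s.lev η (s.β.edges.length + m)).1, h⟩,
        (s.lev η (s.β.edges.length + m)).2, η.initSeg (s.β.edges.length + m), h'⟩ := by
    rintro ⟨⟨x, l, hl⟩, g, β, hd⟩ h1 h2 h3 h4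
    dsimp only at h1 h2 h3 h4
    subst h1 h2 h3 h4
    exact ⟨hl, hd, rfl⟩
  apply key
  · rfl
  · rw [e1]; simp only [FinPath.extend, hr]
  · rw [e1]; simp only [idem] at hr; simp [idem, hr]
  · rfl

theorem germRel_iff {s t : T.Triple} {η μ ζ : T.InfPath} (hs : s.Maps η μ) (ht : t.Maps η ζ) :
    GermRel η s t ↔ ∀ᶠ n in atTop, s.lev η n = t.lev η n := by
  constructor
  · rintro ⟨e, he, hm, hst⟩
    obtain ⟨h1, h2⟩ := idem_eq he
    have he' : e = idem e.β := Triple.ext h1 h2 rfl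
    rw [he'] at hst
    obtain ⟨u, hu, hlu⟩ := mul_idem_lev hs hm.mem_cylinder
    obtain ⟨v, hv, hlv⟩ := mul_idem_lev ht hm.mem_cylinder
    have huv : u = v := Option.some.inj ((hu.symm.trans hst).trans hv)
    filter_upwards [hlu, hlv] with n h3 h4
    rw [← h3, huv, h4]
  · intro h
    obtain ⟨n, hn, hs1, ht1⟩ := (h.and ((eventually_ge_atTop (s.β.edges.length + 1)).and
      (eventually_ge_atTop (t.β.edges.length + 1)))).exists
    refine ⟨idem (η.initSeg n), idem_mul_idem _, idem_maps (η.mem_cylinder_initSeg n), ?_⟩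
    obtain ⟨a, b, e1⟩ := mul_idem_initSeg hs (n := n) (by omega)
    obtain ⟨c, d, e2⟩ := mul_idem_initSeg ht (n := n) (by omega)
    rw [e1, e2]
    refine congrArg some (Triple.ext (FinPath.ext ?_ (congrArg Prod.fst hn))
      (congrArg Prod.snd hn) rfl)
    have c' := c
    rw [← hn] at c'
    refine a.unique c' fun h0 => ?_
    have := congrArg List.length h0
    rw [Triple.length_lev, List.length_nil] at this
    omega

/-- Elements with the same germ at `η` map `η` to the same path. -/
theorem GermRel.eq_of_maps {s t : T.Triple} {η μ ζ : T.InfPath} (h : GermRel η s t)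
    (hs : s.Maps η μ) (ht : t.Maps η ζ) : μ = ζ := by
  rw [germRel_iff hs ht] at h
  have hev := (h.and (hs.take_eq.and ht.take_eq))
  ext1
  refine Stream'.take_theorem _ _ fun k => ?_
  obtain ⟨n, ⟨h1, h2, h3⟩, h4⟩ :=
    (hev.and ((s.tendsto_lev η).eventually_ge_atTop k)).exists
  have : μ.seq.take (s.lev η n).1.length = ζ.seq.take (s.lev η n).1.length := by
    rw [h2, h1, h3]
  have := congrArg (List.take k) this
  rwa [Stream'.take_take, Stream'.take_take, min_eq_right h4] at this

theorem Triple.eventually_of_lev (s : T.Triple) (η : T.InfPath) {p : ℕ → Prop}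
    (h : ∀ᶠ n in atTop, p (s.lev η n).1.length) : ∀ᶠ n in atTop, p n := by
  obtain ⟨N, hN⟩ := eventually_atTop.1 h
  filter_upwards [eventually_ge_atTop (s.α.edges.length + N)] with m hm
  have := hN (m - s.α.edges.length + s.β.edges.length) (by omega)
  rw [Triple.length_lev] at this
  convert this using 1
  omega

theorem Triple.Maps.lev_star {s : T.Triple} {η μ : T.InfPath} (h : s.Maps η μ) :
    ∀ᶠ n in atTop, s.star.lev μ (s.lev η n).1.length =
      (η.seq.take n, (s.lev η n).2⁻¹) := by
  obtain ⟨ξ, h1, h2, h3⟩ := h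
  filter_upwards [eventually_ge_atTop s.β.edges.length] with n hn
  obtain ⟨m, rfl⟩ := Nat.exists_eq_add_of_le hn
  have e := s.star.lev_add (η := μ) h3 m
  rw [s.lev_add h2]
  simp only [List.length_append, length_act, Stream'.length_take]
  simp only [Triple.star] at e ⊢
  rw [e, take_actInf, act_inv_act, coc_inv, h2, stream_take_append]

theorem GermRel.star {s t : T.Triple} {η μ : T.InfPath} (h : GermRel η s t)
    (hs : s.Maps η μ) (ht : t.Maps η μ) : GermRel μ s.star t.star := by
  rw [germRel_iff hs ht] at h
  rw [germRel_iff hs.star ht.star]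
  apply s.eventually_of_lev η
  filter_upwards [h, hs.lev_star, ht.lev_star] with n h1 h2 h3
  rw [h2, h1, h3]

/-! ### The groupoid of germs -/

/-- Equality of germs `[s; η] = [t; η]`, for those `s`, `t` that map `η` to `μ`. -/
def germSetoid (η μ : T.InfPath) : Setoid {s : T.Triple // s.Maps η μ} where
  r s t := GermRel η s.1 t.1
  iseqv := by
    refine ⟨fun s => (germRel_iff s.2 s.2).2 (by simp), fun {s t} h => ?_, fun {s t u} h h' => ?_⟩
    · rw [germRel_iff s.2 t.2] at h
      exact (germRel_iff t.2 s.2).2 (h.mono fun _ => Eq.symm)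
    · rw [germRel_iff s.2 t.2] at h
      rw [germRel_iff t.2 u.2] at h'
      exact (germRel_iff s.2 u.2).2 ((h.and h').mono fun _ h => h.1.trans h.2)

/-- The germs `[s; η]` with source `η` and range `s · η = μ`. -/
def GermHom (η μ : T.InfPath) := Quotient (germSetoid η μ)

/-- The germ `[s; η]`, as an arrow from `η` to `s · η = μ`. -/
def germ {η μ : T.InfPath} (s : T.Triple) (h : s.Maps η μ) : GermHom η μ :=
  Quotient.mk (germSetoid η μ) ⟨s, h⟩

theorem germ_eq_iff {η μ : T.InfPath} {s t : T.Triple} (hs : s.Maps η μ) (ht : t.Maps η μ) :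
    germ s hs = germ t ht ↔ GermRel η s t :=
  Quotient.eq (r := germSetoid η μ)

theorem germ_eq_iff_lev {η μ : T.InfPath} {s t : T.Triple} (hs : s.Maps η μ)
    (ht : t.Maps η μ) :
    germ s hs = germ t ht ↔ ∀ᶠ n in atTop, s.lev η n = t.lev η n := by
  rw [germ_eq_iff, germRel_iff hs ht]

/-- The nonzero product `s t`, when `t · η = μ` and `s · μ = ζ`. -/
noncomputable def mulOf {s t : T.Triple} {η μ ζ : T.InfPath} (ht : t.Maps η μ)
    (hs : s.Maps μ ζ) : T.Triple :=
  (s.mul t).get (by obtain ⟨u, hu, -⟩ := ht.mul hs; rw [hu]; rfl)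

theorem toSGE_mulOf {s t : T.Triple} {η μ ζ : T.InfPath} (ht : t.Maps η μ)
    (hs : s.Maps μ ζ) : (mulOf ht hs).toSGE = s.toSGE * t.toSGE :=
  Option.some_get _

theorem mulOf_spec {s t : T.Triple} {η μ ζ : T.InfPath} (ht : t.Maps η μ)
    (hs : s.Maps μ ζ) : (mulOf ht hs).Maps η ζ ∧
      ∀ᶠ n in atTop, (mulOf ht hs).lev η n = ((s.lev μ (t.lev η n).1.length).1,
        (s.lev μ (t.lev η n).1.length).2 * (t.lev η n).2) := by
  obtain ⟨u, hu, h⟩ := ht.mul hs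
  have : mulOf ht hs = u := by
    have := toSGE_mulOf ht hs
    rw [toSGE_mul, hu] at this
    exact Option.some.inj this
  rw [this]; exact h

/-- Composition of germs, `[s; t · η] [t; η] = [s t; η]`. -/
noncomputable def germComp {η μ ζ : T.InfPath} (b : GermHom η μ) (a : GermHom μ ζ) :
    GermHom η ζ :=
  Quotient.liftOn₂ (s₁ := germSetoid η μ) (s₂ := germSetoid μ ζ) b a
    (fun t s => germ (mulOf t.2 s.2) (mulOf_spec t.2 s.2).1) (by
      intro t s t' s' ht hs
      have ht := (germRel_iff t.2 t'.2).1 ht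
      have hs := (germRel_iff s.2 s'.2).1 hs
      rw [germ_eq_iff_lev]
      filter_upwards [ht, (t.1.tendsto_lev η).eventually hs, (mulOf_spec t.2 s.2).2,
        (mulOf_spec t'.2 s'.2).2] with n h1 h2 h3 h4
      rw [h3, h4, h2, h1])

theorem germComp_germ {η μ ζ : T.InfPath} {s t : T.Triple} (ht : t.Maps η μ)
    (hs : s.Maps μ ζ) :
    germComp (germ t ht) (germ s hs) = germ (mulOf ht hs) (mulOf_spec ht hs).1 := rfl

/-- The inverse of a germ, `[s; η]⁻¹ = [s*; s · η]`. -/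
def germInv {η μ : T.InfPath} (a : GermHom η μ) : GermHom μ η :=
  Quotient.liftOn (s := germSetoid η μ) a (fun s => germ s.1.star s.2.star) (by
    intro s t hst
    rw [germ_eq_iff]
    exact GermRel.star hst s.2 t.2)

theorem exists_germ {η μ : T.InfPath} (a : GermHom η μ) :
    ∃ (s : T.Triple) (h : s.Maps η μ), a = germ s h := by
  refine Quotient.inductionOn (s := germSetoid η μ) a fun s => ⟨s.1, s.2, rfl⟩

/-- The germ `[x, 1, x; η]` with `x` the range of `η`. -/
def germOne (η : T.InfPath) : GermHom η η :=
  germ (idem (η.initSeg 0)) (idem_maps (η.mem_cylinder_initSeg 0))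

theorem germComp_germ_eq_iff {η μ ζ : T.InfPath} {s t u : T.Triple} (ht : t.Maps η μ)
    (hs : s.Maps μ ζ) (hu : u.Maps η ζ) :
    germComp (germ t ht) (germ s hs) = germ u hu ↔
      ∀ᶠ n in atTop, u.lev η n = ((s.lev μ (t.lev η n).1.length).1,
        (s.lev μ (t.lev η n).1.length).2 * (t.lev η n).2) := by
  rw [germComp_germ, germ_eq_iff_lev]
  have h := (mulOf_spec ht hs).2
  constructor
  · intro h'
    filter_upwards [h, h'] with n h1 h2
    rw [← h2, h1]
  · intro h'
    filter_upwards [h, h'] with n h1 h2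
    rw [h2, h1]

/-- The groupoid of germs of the action of the inverse semigroup of `(G, E, φ)` on the space of
infinite paths. The objects (units) are the infinite paths, and an arrow `[s; η]` goes from its
source `η` to its range `s · η`. In the diagrammatic notation of category theory, the product
`a b` of the groupoid elements `a` and `b` is the composition `b ≫ a`. -/
noncomputable instance : Groupoid T.InfPath where
  Hom η μ := GermHom η μ
  id η := germOne η
  comp b a := germComp b a
  inv a := germInv a
  id_comp {η μ} a := by
    obtain ⟨s, hs, rfl⟩ := exists_germ a
    refine (germComp_germ_eq_iff _ _ _).2 ?_
    filter_upwards [lev_idem (InfPath.mem_cylinder_initSeg η 0)] with n h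
    rw [h]; simp
  comp_id {η μ} a := by
    obtain ⟨s, hs, rfl⟩ := exists_germ a
    refine (germComp_germ_eq_iff _ _ _).2 ?_
    filter_upwards [(s.tendsto_lev _).eventually (lev_idem (InfPath.mem_cylinder_initSeg μ 0)),
      hs.take_eq] with n h h'
    rw [h]; simp [h']
  assoc {η _ _ _} c b a := by
    obtain ⟨u, hu, rfl⟩ := exists_germ c
    obtain ⟨t, ht, rfl⟩ := exists_germ b
    obtain ⟨s, hs, rfl⟩ := exists_germ a
    rw [germComp_germ hu ht, germComp_germ ht hs, germComp_germ, eq_comm, germComp_germ_eq_iff]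
    filter_upwards [(mulOf_spec (mulOf_spec hu ht).1 hs).2, (mulOf_spec hu ht).2,
      (u.tendsto_lev η).eventually (mulOf_spec ht hs).2] with n h1 h2 h3
    rw [h1, h2]
    simp [h3, mul_assoc]
  inv_comp {η μ} a := by
    obtain ⟨s, hs, rfl⟩ := exists_germ a
    refine (germComp_germ_eq_iff _ _ _).2 ?_
    apply s.eventually_of_lev
    filter_upwards [hs.lev_star, hs.take_eq, (s.tendsto_lev _).eventually
      (lev_idem (InfPath.mem_cylinder_initSeg μ 0))] with n h1 h2 h3
    rw [h1, h3]; simp [h2]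
  comp_inv {η μ} a := by
    obtain ⟨s, hs, rfl⟩ := exists_germ a
    refine (germComp_germ_eq_iff _ _ _).2 ?_
    filter_upwards [hs.lev_star, lev_idem (InfPath.mem_cylinder_initSeg η 0)] with n h1 h2
    rw [h1, h2]; simp

end GraphTriple

/-! ### Steinberg algebras -/

section Steinberg

variable {X : Type*} [Groupoid X]

/-- A bisection of a groupoid: a set of arrows on which the source map and the range map are
injective. -/
def IsBisection (B : Set (Quiver.Total X)) : Prop :=
  Set.InjOn Quiver.Total.left B ∧ Set.InjOn Quiver.Total.right B

/-- The product `B D` of two sets of arrows. -/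
def setMul (B D : Set (Quiver.Total X)) : Set (Quiver.Total X) :=
  {c | ∃ (y : X) (d : c.left ⟶ y) (b : y ⟶ c.right), d ≫ b = c.hom ∧
    (⟨y, c.right, b⟩ : Quiver.Total X) ∈ B ∧ (⟨c.left, y, d⟩ : Quiver.Total X) ∈ D}

/-- The factorizations `c = b d` of an arrow `c` of a groupoid: composable pairs `(b, d)` with
product `c`. In diagrammatic notation, the product `b d` is `d ≫ b`. -/
@[ext] structure Factorization (c : Quiver.Total X) where
  mid : X
  d : c.left ⟶ mid
  b : mid ⟶ c.right
  comp_eq : d ≫ b = c.hom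

/-- The first factor `b` of a factorization `c = b d`. -/
def Factorization.fst {c : Quiver.Total X} (p : Factorization c) : Quiver.Total X :=
  ⟨p.mid, c.right, p.b⟩

/-- The second factor `d` of a factorization `c = b d`. -/
def Factorization.snd {c : Quiver.Total X} (p : Factorization c) : Quiver.Total X :=
  ⟨c.left, p.mid, p.d⟩

/-- The convolution product of two functions on a groupoid: the value at `c` is the sum of
`f b * g d` over all composable pairs `(b, d)` with product `c`. -/
noncomputable def conv {R : Type*} [CommRing R] (f g : Quiver.Total X → R) :
    Quiver.Total X → R :=
  fun c => ∑ᶠ p : Factorization c, f p.fst * g p.snd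

/-- The underlying module of the Steinberg algebra: the span of the characteristic functions of
compact open bisections. -/
def steinbergModule (R X : Type*) [CommRing R] [Groupoid X]
    [TopologicalSpace (Quiver.Total X)] : Submodule R (Quiver.Total X → R) :=
  Submodule.span R {f | ∃ B : Set (Quiver.Total X), IsOpen B ∧ IsCompact B ∧ IsBisection B ∧
    f = B.indicator 1}

/-- The Steinberg algebra `A_R(𝒢)` of an ample groupoid `𝒢` with unit space `X` and arrow space
`Quiver.Total X`. -/
def SteinbergAlgebra (R X : Type*) [CommRing R] [Groupoid X]
    [TopologicalSpace (Quiver.Total X)] : Type _ :=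
  ↥(steinbergModule R X)

variable {R : Type*} [CommRing R]

theorem Factorization.snd_injective {c : Quiver.Total X} :
    Function.Injective (Factorization.snd (c := c)) := by
  rintro ⟨y, d, b, h⟩ ⟨y', d', b', h'⟩ e
  simp only [Factorization.snd, Quiver.Total.mk.injEq, true_and] at e
  obtain ⟨rfl, e⟩ := e
  obtain rfl := eq_of_heq e
  obtain rfl := (cancel_epi d).1 (h.trans h'.symm)
  rfl

theorem mem_setMul {B D : Set (Quiver.Total X)} {c : Quiver.Total X} :
    c ∈ setMul B D ↔ ∃ p : Factorization c, p.fst ∈ B ∧ p.snd ∈ D :=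
  ⟨fun ⟨y, d, b, h, hb, hd⟩ => ⟨⟨y, d, b, h⟩, hb, hd⟩,
    fun ⟨⟨y, d, b, h⟩, hb, hd⟩ => ⟨y, d, b, h, hb, hd⟩⟩

/-- Functions with finitely many nonzero values on the arrows with a given source. -/
def SourceFinite (f : Quiver.Total X → R) : Prop :=
  ∀ x : X, {c : Quiver.Total X | c.left = x ∧ f c ≠ 0}.Finite

theorem SourceFinite.finite_support {f g : Quiver.Total X → R} (hg : SourceFinite g)
    (c : Quiver.Total X) :
    (Function.support fun p : Factorization c => f p.fst * g p.snd).Finite := by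
  refine Set.Finite.of_finite_image ((hg c.left).subset ?_) Factorization.snd_injective.injOn
  rintro _ ⟨p, hp, rfl⟩
  exact ⟨rfl, right_ne_zero_of_mul hp⟩

theorem conv_add_left {f f' g : Quiver.Total X → R} (hg : SourceFinite g) :
    conv (f + f') g = conv f g + conv f' g := by
  funext c
  simp only [conv, Pi.add_apply, add_mul]
  exact finsum_add_distrib (hg.finite_support c) (hg.finite_support c)

theorem conv_add_right {f g g' : Quiver.Total X → R} (hg : SourceFinite g)
    (hg' : SourceFinite g') : conv f (g + g') = conv f g + conv f g' := by
  funext c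
  simp only [conv, Pi.add_apply, mul_add]
  exact finsum_add_distrib (hg.finite_support c) (hg'.finite_support c)

theorem conv_smul_left {f g : Quiver.Total X → R} (r : R) (hg : SourceFinite g) :
    conv (r • f) g = r • conv f g := by
  funext c
  simp only [conv, Pi.smul_apply, smul_eq_mul, mul_assoc]
  exact (mul_finsum' _ r (hg.finite_support c)).symm

theorem conv_smul_right {f g : Quiver.Total X → R} (r : R) (hg : SourceFinite g) :
    conv f (r • g) = r • conv f g := by
  funext c
  simp only [conv, Pi.smul_apply, smul_eq_mul, mul_left_comm]
  exact (mul_finsum' _ r (hg.finite_support c)).symm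

@[simp] theorem conv_zero_left (g : Quiver.Total X → R) : conv 0 g = 0 := by
  funext c; simp [conv]

@[simp] theorem conv_zero_right (f : Quiver.Total X → R) : conv f 0 = 0 := by
  funext c; simp [conv]

theorem conv_indicator {B D : Set (Quiver.Total X)} (hD : IsBisection D) :
    conv (B.indicator (1 : Quiver.Total X → R)) (D.indicator 1) = (setMul B D).indicator 1 := by
  classical
  funext c
  by_cases hc : c ∈ setMul B D
  · obtain ⟨p, hb, hd⟩ := mem_setMul.1 hc
    rw [Set.indicator_of_mem hc, conv, finsum_eq_single _ p]
    · simp [hb, hd]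
    · intro q hq
      have : q.snd ∉ D := fun h => hq (Factorization.snd_injective (hD.1 h hd rfl))
      simp [this]
  · rw [Set.indicator_of_notMem hc, conv]
    refine finsum_eq_zero_of_forall_eq_zero fun p => ?_
    by_contra h
    refine hc (mem_setMul.2 ⟨p, ?_, ?_⟩)
    · by_contra h'; simp [h'] at h
    · by_contra h'; simp [h'] at h

theorem IsBisection.setMul {B D : Set (Quiver.Total X)} (hB : IsBisection B)
    (hD : IsBisection D) : IsBisection (setMul B D) := by
  constructor
  · rintro ⟨x, z, c⟩ ⟨y, d, b, h, hb, hd⟩ ⟨x', z', c'⟩ ⟨y', d', b', h', hb', hd'⟩ e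
    dsimp only at d b h hb hd d' b' h' hb' hd' e
    subst e
    have e1 := hD.1 hd hd' rfl
    simp only [Quiver.Total.mk.injEq, true_and] at e1
    obtain ⟨rfl, e1⟩ := e1
    obtain rfl := eq_of_heq e1
    have e2 := hB.1 hb hb' rfl
    simp only [Quiver.Total.mk.injEq, true_and] at e2
    obtain ⟨rfl, e2⟩ := e2
    obtain rfl := eq_of_heq e2
    rw [← h, ← h']
  · rintro ⟨x, z, c⟩ ⟨y, d, b, h, hb, hd⟩ ⟨x', z', c'⟩ ⟨y', d', b', h', hb', hd'⟩ e
    dsimp only at d b h hb hd d' b' h' hb' hd' e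
    subst e
    have e1 := hB.2 hb hb' rfl
    simp only [Quiver.Total.mk.injEq, true_and] at e1
    obtain ⟨rfl, e1⟩ := e1
    obtain rfl := eq_of_heq e1
    have e2 := hD.2 hd hd' rfl
    simp only [Quiver.Total.mk.injEq] at e2
    obtain ⟨rfl, -, e2⟩ := e2
    obtain rfl := eq_of_heq e2
    rw [← h, ← h']

theorem setMul_assoc (B C D : Set (Quiver.Total X)) :
    setMul (setMul B C) D = setMul B (setMul C D) := by
  ext ⟨x, w, a⟩
  constructor
  · rintro ⟨y, d, e, h, ⟨z, c, b, h', hb, hc⟩, hd⟩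
    dsimp only at d e h c b h' hb hc hd
    exact ⟨z, d ≫ c, b, by rw [Category.assoc, h', h], hb, y, d, c, rfl, hc, hd⟩
  · rintro ⟨y, e, b, h, hb, ⟨z, d, c, h', hc, hd⟩⟩
    dsimp only at e b h hb c d h' hc hd
    exact ⟨z, d, c ≫ b, by rw [← Category.assoc, h', h], ⟨y, c, b, rfl, hb, hc⟩, hd⟩

/-- The unit space, as a set of arrows. -/
def unitArrows (X : Type*) [Groupoid X] : Set (Quiver.Total X) :=
  Set.range fun x => ⟨x, x, 𝟙 x⟩

theorem isBisection_unitArrows : IsBisection (unitArrows X) := by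
  constructor <;>
  · rintro _ ⟨x, rfl⟩ _ ⟨y, rfl⟩ (h : x = y)
    rw [h]

theorem unitArrows_setMul (B : Set (Quiver.Total X)) : setMul (unitArrows X) B = B := by
  ext ⟨x, w, a⟩
  constructor
  · rintro ⟨y, d, e, h, ⟨z, hz⟩, hd⟩
    simp only [Quiver.Total.mk.injEq] at hz
    obtain ⟨rfl, rfl, hz⟩ := hz
    obtain rfl := eq_of_heq hz
    dsimp only at d h hd
    rw [← h]; simpa using hd
  · exact fun h => ⟨w, a, 𝟙 w, Category.comp_id a, ⟨w, rfl⟩, h⟩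

theorem setMul_unitArrows (B : Set (Quiver.Total X)) : setMul B (unitArrows X) = B := by
  ext ⟨x, w, a⟩
  constructor
  · rintro ⟨y, d, e, h, hd, ⟨z, hz⟩⟩
    simp only [Quiver.Total.mk.injEq] at hz
    obtain ⟨rfl, rfl, hz⟩ := hz
    obtain rfl := eq_of_heq hz
    dsimp only at e h hd
    rw [← h]; simpa using hd
  · exact fun h => ⟨x, 𝟙 x, a, Category.id_comp a, h, ⟨x, rfl⟩⟩

variable [TopologicalSpace (Quiver.Total X)]

theorem sourceFinite_of_mem {f : Quiver.Total X → R} (hf : f ∈ steinbergModule R X) :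
    SourceFinite f := by
  classical
  induction hf using Submodule.span_induction with
  | mem f hf =>
    obtain ⟨B, -, -, hB, rfl⟩ := hf
    intro x
    refine Set.Subsingleton.finite ?_
    rintro a ⟨ha, ha'⟩ b ⟨hb, hb'⟩
    exact hB.1 (Set.mem_of_indicator_ne_zero ha') (Set.mem_of_indicator_ne_zero hb')
      (ha.trans hb.symm)
  | zero => intro x; simp
  | add f g _ _ hf hg =>
    intro x
    refine ((hf x).union (hg x)).subset ?_
    rintro a ⟨ha, ha'⟩
    by_cases h : f a = 0
    · exact Or.inr ⟨ha, fun h' => ha' (by simp [h, h'])⟩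
    · exact Or.inl ⟨ha, h⟩
  | smul r f _ hf =>
    intro x
    refine (hf x).subset ?_
    rintro a ⟨ha, ha'⟩
    exact ⟨ha, fun h => ha' (by simp [h])⟩

end Steinberg

namespace GraphTriple
variable {T : GraphTriple G V A}

/-! ### The topology of the groupoid of germs -/

/-- The infinite path space carries the topology inherited from the product of copies of the
discrete space of edges. -/
instance : TopologicalSpace T.InfPath :=
  TopologicalSpace.induced InfPath.seq (@Pi.topologicalSpace ℕ (fun _ => A) fun _ => ⊥)

/-- `Θ(s; Z(γ))`: the set of all germs `[s; ξ]` with `ξ ∈ Z(γ)`. -/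
def Theta (s : T.Triple) (γ : T.FinPath) : Set (Quiver.Total T.InfPath) :=
  {a | a.left ∈ cylinder γ ∧ ∃ h : s.Maps a.left a.right, a.hom = germ s h}

/-- The topology of the groupoid of germs, with the sets `Θ(s; Z(γ))` as a basis. -/
instance : TopologicalSpace (Quiver.Total T.InfPath) :=
  TopologicalSpace.generateFrom
    {U | ∃ (s : T.Triple) (γ : T.FinPath), U = Theta s γ}

theorem isOpen_of_take {S : Set T.InfPath} (N : ℕ)
    (h : ∀ η ∈ S, ∀ ξ : T.InfPath, (∀ k < N, ξ.seq k = η.seq k) → ξ ∈ S) : IsOpen S := by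
  let _ : TopologicalSpace A := ⊥
  have _ : DiscreteTopology A := ⟨rfl⟩
  have hc : ∀ k, Continuous fun ξ : T.InfPath => ξ.seq k := fun k =>
    (continuous_apply k).comp (continuous_induced_dom (f := InfPath.seq (T := T)))
  rw [isOpen_iff_mem_nhds]
  intro η hη
  have : IsOpen (⋂ k ∈ Finset.range N, (fun ξ : T.InfPath => ξ.seq k) ⁻¹' {η.seq k}) :=
    isOpen_biInter_finset fun k _ => (isOpen_discrete _).preimage (hc k)
  refine mem_of_superset (this.mem_nhds (by simp)) fun ξ hξ => h η hη ξ fun k hk => ?_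
  simp only [Finset.mem_range, Set.mem_iInter] at hξ
  exact hξ k hk

theorem stream_take_congr {ξ η : Stream' A} {N : ℕ} (h : ∀ k < N, ξ k = η k) :
    ξ.take N = η.take N := by
  induction N with
  | zero => rfl
  | succ n ih =>
    rw [Stream'.take_succ', Stream'.take_succ', ih fun k hk => h k (by omega)]
    exact congrArg _ (congrArg (fun a => [a]) (h n (by omega)))

theorem cylinder_congr {γ : T.FinPath} {ξ η : T.InfPath}
    (h : ∀ k < γ.edges.length + 1, ξ.seq k = η.seq k) : ξ ∈ cylinder γ ↔ η ∈ cylinder γ := by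
  rw [mem_cylinder, mem_cylinder, InfPath.rng, InfPath.rng, h 0 (by omega),
    stream_take_congr fun k hk => h k (by omega)]

theorem isOpen_cylinder (γ : T.FinPath) : IsOpen (cylinder γ) :=
  isOpen_of_take (γ.edges.length + 1) fun _ hη _ h => (cylinder_congr h).2 hη

theorem isClosed_cylinder (γ : T.FinPath) : IsClosed (cylinder γ) :=
  ⟨isOpen_of_take (γ.edges.length + 1) fun _ hη _ h h' => hη ((cylinder_congr h).1 h')⟩

instance [Finite A] : CompactSpace T.InfPath := by
  let _ : TopologicalSpace A := ⊥
  have _ : DiscreteTopology A := ⟨rfl⟩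
  let f : T.InfPath → (ℕ → A) := InfPath.seq
  have hr : Set.range f = {x : ℕ → A | ∀ n, T.s (x n) = T.r (x (n + 1))} := by
    ext x
    exact ⟨fun ⟨ξ, h⟩ => h ▸ ξ.valid, fun h => ⟨⟨x, h⟩, rfl⟩⟩
  have hcl : IsClosed (Set.range f) := by
    rw [hr, Set.ofPred_forall]
    refine isClosed_iInter fun n => ?_
    have : Continuous fun x : ℕ → A => (x n, x (n + 1)) := by fun_prop
    exact (isClosed_discrete {p : A × A | T.s p.1 = T.r p.2}).preimage this
  have he : Topology.IsClosedEmbedding f :=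
    ⟨⟨⟨rfl⟩, fun ξ η h => InfPath.ext h⟩, hcl⟩
  exact he.compactSpace

theorem cylinder_initSeg_subset {γ : T.FinPath} {η : T.InfPath} (h : η ∈ cylinder γ) {n : ℕ}
    (hn : γ.edges.length ≤ n) : cylinder (η.initSeg n) ⊆ cylinder γ := by
  intro ξ hξ
  rw [mem_cylinder] at h hξ ⊢
  refine ⟨hξ.1.trans h.1, ?_⟩
  have h2 := congrArg (List.take γ.edges.length) hξ.2
  simp only [InfPath.initSeg, Stream'.length_take, Stream'.take_take] at h2
  rw [min_eq_right hn, h.2] at h2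
  exact h2

theorem isOpen_Theta (s : T.Triple) (γ : T.FinPath) : IsOpen (Theta s γ) :=
  TopologicalSpace.isOpen_generateFrom_of_mem ⟨s, γ, rfl⟩

theorem Theta_isBisection (s : T.Triple) (γ : T.FinPath) : IsBisection (Theta s γ) := by
  constructor
  · rintro ⟨x, y, a⟩ ⟨-, h, e⟩ ⟨x', y', a'⟩ ⟨-, h', e'⟩ hx
    dsimp only at h e h' e' hx
    subst hx
    obtain rfl := h.unique h'
    rw [e, e']
  · rintro ⟨x, y, a⟩ ⟨-, h, e⟩ ⟨x', y', a'⟩ ⟨-, h', e'⟩ hx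
    dsimp only at h e h' e' hx
    subst hx
    obtain rfl := h.inj h'
    rw [e, e']

/-- If `s` and `t` have the same germ at `η`, they do so at all nearby points. -/
theorem GermRel.exists_cylinder {s t : T.Triple} {η : T.InfPath} (h : GermRel η s t) :
    ∃ γ : T.FinPath, η ∈ cylinder γ ∧ ∀ ξ ∈ cylinder γ, GermRel ξ s t := by
  obtain ⟨e, he, hm, hst⟩ := h
  refine ⟨e.β, hm.mem_cylinder, fun ξ hξ => ⟨e, he, ?_, hst⟩⟩
  have h' : e = idem e.β := Triple.ext (idem_eq he).1 (idem_eq he).2 rfl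
  rw [h']; exact idem_maps hξ

theorem exists_Theta_subset {U : Set (Quiver.Total T.InfPath)} (hU : IsOpen U)
    {a : Quiver.Total T.InfPath} (ha : a ∈ U) {s : T.Triple} (hs : s.Maps a.left a.right)
    (e : a.hom = germ s hs) : ∀ᶠ n in atTop, Theta s (a.left.initSeg n) ⊆ U := by
  induction hU with
  | basic U hU =>
    obtain ⟨t, γ, rfl⟩ := hU
    obtain ⟨hγ, ht, e'⟩ := ha
    have hst := (germ_eq_iff hs ht).1 (e.symm.trans e')
    obtain ⟨δ, hδ, H⟩ := hst.exists_cylinder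
    filter_upwards [eventually_ge_atTop γ.edges.length, eventually_ge_atTop δ.edges.length,
      eventually_ge_atTop t.β.edges.length] with n h1 h2 h3
    rintro ⟨x, y, b⟩ ⟨hx, hsx, eb⟩
    dsimp only at hx hsx eb
    obtain ⟨ζ, htx⟩ := Triple.exists_maps (cylinder_initSeg_subset ht.mem_cylinder h3 hx)
    have hr := H x (cylinder_initSeg_subset hδ h2 hx)
    obtain rfl := hr.eq_of_maps hsx htx
    exact ⟨cylinder_initSeg_subset hγ h1 hx, htx, eb.trans ((germ_eq_iff hsx htx).2 hr)⟩
  | univ => exact Eventually.of_forall fun n => Set.subset_univ _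
  | inter U W _ _ h1 h2 =>
    filter_upwards [h1 ha.1, h2 ha.2] with n h h' using Set.subset_inter h h'
  | sUnion S _ h =>
    obtain ⟨U, hU, haU⟩ := ha
    filter_upwards [h U hU haU] with n hn using hn.trans (Set.subset_sUnion_of_mem hU)

theorem isTopologicalBasis_Theta :
    TopologicalSpace.IsTopologicalBasis (Set.range fun s : T.Triple => Theta s s.β) := by
  refine TopologicalSpace.isTopologicalBasis_of_isOpen_of_nhds ?_ fun a U ha hU => ?_
  · rintro _ ⟨s, rfl⟩
    exact isOpen_Theta s _
  · obtain ⟨s, hs, e⟩ := exists_germ a.hom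
    obtain ⟨n, hn, hsn⟩ := ((exists_Theta_subset hU ha hs e).and
      (eventually_ge_atTop s.β.edges.length)).exists
    obtain ⟨h, h', hu⟩ := mul_idem_initSeg hs hsn
    have key : ∀ {ξ ζ : T.InfPath}, ξ ∈ cylinder (a.left.initSeg n) → s.Maps ξ ζ →
        ∃ h1 : Triple.Maps ⟨⟨s.α.rng, (s.lev a.left n).1, h⟩, (s.lev a.left n).2,
          a.left.initSeg n, h'⟩ ξ ζ, ∀ hs' : s.Maps ξ ζ, germ _ h1 = germ s hs' := by
      intro ξ ζ hξ hs'
      obtain ⟨u, hu1, hu2, hu3⟩ := (idem_maps hξ).mul hs'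
      obtain rfl := Option.some.inj (hu1.symm.trans hu)
      refine ⟨hu2, fun hs' => (germ_eq_iff_lev _ _).2 ?_⟩
      filter_upwards [hu3, lev_idem hξ] with n h1 h2
      rw [h1, h2]; simp
    refine ⟨_, ⟨⟨⟨s.α.rng, (s.lev a.left n).1, h⟩, (s.lev a.left n).2, a.left.initSeg n, h'⟩,
      rfl⟩, ?_, Set.Subset.trans ?_ hn⟩
    · obtain ⟨h1, h2⟩ := key (a.left.mem_cylinder_initSeg n) hs
      exact ⟨a.left.mem_cylinder_initSeg n, h1, e.trans (h2 hs).symm⟩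
    · rintro ⟨x, y, b⟩ ⟨hx, hux, eb⟩
      dsimp only at hx hux eb
      obtain ⟨ζ, hsx⟩ := Triple.exists_maps (cylinder_initSeg_subset hs.mem_cylinder hsn hx)
      obtain ⟨h1, h2⟩ := key hx hsx
      obtain rfl := hux.unique h1
      exact ⟨hx, hsx, eb.trans (h2 hsx)⟩

theorem isCompact_Theta [Finite A] (s : T.Triple) : IsCompact (Theta s s.β) := by
  have hK : CompactSpace (cylinder s.β) :=
    isCompact_iff_compactSpace.1 (isClosed_cylinder s.β).isCompact
  choose m hm using fun η : cylinder s.β => Triple.exists_maps η.2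
  let f : cylinder s.β → Quiver.Total T.InfPath := fun η => ⟨η, m η, germ s (hm η)⟩
  have hf : Continuous f := by
    refine continuous_generateFrom_iff.2 ?_
    rintro _ ⟨t, γ, rfl⟩
    rw [isOpen_iff_mem_nhds]
    rintro η ⟨hγ, ht, e⟩
    dsimp only [f] at hγ ht e
    obtain ⟨δ, hδ, H⟩ := ((germ_eq_iff (hm η) ht).1 e).exists_cylinder
    have ho := (((isOpen_cylinder γ).inter (isOpen_cylinder δ)).inter
      (isOpen_cylinder t.β)).preimage (continuous_subtype_val (p := (· ∈ cylinder s.β)))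
    refine mem_of_superset (ho.mem_nhds ⟨⟨hγ, hδ⟩, ht.mem_cylinder⟩) ?_
    rintro ξ ⟨⟨h1, h2⟩, h3⟩
    obtain ⟨ζ, htx⟩ := Triple.exists_maps h3
    obtain rfl := (H ξ h2).eq_of_maps (hm ξ) htx
    exact ⟨h1, htx, (germ_eq_iff _ _).2 (H ξ h2)⟩
  convert isCompact_range hf
  ext ⟨x, y, a⟩
  constructor
  · rintro ⟨hx, hs, e⟩
    dsimp only at hx hs e
    refine ⟨⟨x, hx⟩, ?_⟩
    obtain rfl := hs.unique (hm ⟨x, hx⟩)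
    rw [e]
  · rintro ⟨η, h⟩
    rw [← h]
    exact ⟨η.2, hm η, rfl⟩

/-- The product `Θ_s Θ_t` is `Θ_{s t}`. -/
theorem setMul_Theta_of_some {s t u : T.Triple} (h : s.mul t = some u) :
    setMul (Theta s s.β) (Theta t t.β) = Theta u u.β := by
  ext ⟨x, z, c⟩
  constructor
  · rintro ⟨y, d, b, hc, ⟨hy, hs, e⟩, ⟨hx, ht, e'⟩⟩
    dsimp only at d b hc hy hs e hx ht e'
    obtain ⟨u', hu, hu', hl⟩ := ht.mul hs
    obtain rfl := Option.some.inj (h.symm.trans hu)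
    refine ⟨hu'.mem_cylinder, hu', ?_⟩
    dsimp only
    rw [← hc, e, e']
    exact (germComp_germ_eq_iff ht hs hu').2 hl
  · rintro ⟨hx, hu, e⟩
    dsimp only at hx hu e
    have key : ∃ y, t.Maps x y ∧ y ∈ cylinder s.β := by
      rw [Triple.mul] at h
      split_ifs at h with h1 h2
      · obtain rfl := Option.some.inj h
        obtain ⟨y, hy⟩ := Triple.exists_maps (s := t) hx
        refine ⟨y, hy, ?_⟩
        have h3 := mem_cylinder.1 hy.mem_cylinder'
        rw [mem_cylinder]
        refine ⟨h3.1.trans h1.1.symm, ?_⟩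
        have h4 := congrArg (List.take s.β.edges.length) h3.2
        rw [Stream'.take_take, min_eq_right h1.2.length_le] at h4
        rw [h4]
        exact (List.prefix_iff_eq_take.1 h1.2).symm
      · obtain rfl := Option.some.inj h
        obtain ⟨ξ, h3, h4⟩ := hx
        simp only [FinPath.extend, Stream'.append_append_stream] at h4
        have h5 : x ∈ cylinder t.β := by
          rw [mem_cylinder, rng_of_append h3 (by
            rw [h4, ← Stream'.append_append_stream]; rfl)]
          refine ⟨rfl, ?_⟩
          rw [h4]
          simpa using stream_take_append t.β.edges _ 0
        obtain ⟨y, hy⟩ := Triple.exists_maps h5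
        refine ⟨y, hy, ?_⟩
        have h7 := mem_cylinder.1 hy.mem_cylinder'
        rw [mem_cylinder]
        refine ⟨h7.1.trans h2.1, ?_⟩
        obtain ⟨ξ', h8, h9, h10⟩ := hy
        have h11 := stream_append_left_cancel (h9.symm.trans h4)
        rw [h11, actInf_append, act_act_inv, ← Stream'.append_append_stream,
          h2.append_remainder] at h10
        rw [h10]
        simpa using stream_take_append s.β.edges _ 0
    obtain ⟨y, hy, hys⟩ := key
    obtain ⟨z', hz⟩ := Triple.exists_maps hys
    obtain ⟨u', hu1, hu2, hl⟩ := hy.mul hz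
    obtain rfl := Option.some.inj (h.symm.trans hu1)
    obtain rfl := hu.unique hu2
    exact ⟨y, germ t hy, germ s hz, ((germComp_germ_eq_iff hy hz hu).2 hl).trans e.symm,
      ⟨hys, hz, rfl⟩, ⟨hy.mem_cylinder, hy, rfl⟩⟩

theorem setMul_Theta_of_none {s t : T.Triple} (h : s.mul t = none) :
    setMul (Theta s s.β) (Theta t t.β) = ∅ := by
  rw [Set.eq_empty_iff_forall_notMem]
  rintro ⟨x, z, c⟩ ⟨y, d, b, hc, ⟨hy, hs, e⟩, ⟨hx, ht, e'⟩⟩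
  obtain ⟨u, hu, -⟩ := ht.mul hs
  rw [h] at hu
  cases hu

theorem isCompact_isOpen_setMul_Theta [Finite A] (s t : T.Triple) :
    IsCompact (setMul (Theta s s.β) (Theta t t.β)) ∧
      IsOpen (setMul (Theta s s.β) (Theta t t.β)) := by
  cases h : s.mul t with
  | none => rw [setMul_Theta_of_none h]; exact ⟨isCompact_empty, isOpen_empty⟩
  | some u => rw [setMul_Theta_of_some h]; exact ⟨isCompact_Theta u, isOpen_Theta u _⟩

theorem isCompact_isOpen_setMul [Finite A] {B D : Set (Quiver.Total T.InfPath)}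
    (hB : IsCompact B ∧ IsOpen B) (hD : IsCompact D ∧ IsOpen D) :
    IsCompact (setMul B D) ∧ IsOpen (setMul B D) := by
  have hc := isCompact_open_iff_eq_finite_iUnion_of_isTopologicalBasis
    (fun s : T.Triple => Theta s s.β) isTopologicalBasis_Theta isCompact_Theta
  obtain ⟨S, hS, rfl⟩ := (hc B).1 hB
  obtain ⟨S', hS', rfl⟩ := (hc D).1 hD
  have : setMul (⋃ s ∈ S, Theta s s.β) (⋃ t ∈ S', Theta t t.β) =
      ⋃ s ∈ S, ⋃ t ∈ S', setMul (Theta s s.β) (Theta t t.β) := by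
    ext c
    simp only [mem_setMul, Set.mem_iUnion]
    constructor
    · rintro ⟨p, ⟨s, hs, h⟩, ⟨t, ht, h'⟩⟩
      exact ⟨s, hs, t, ht, p, h, h'⟩
    · rintro ⟨s, hs, t, ht, p, h, h'⟩
      exact ⟨p, ⟨s, hs, h⟩, ⟨t, ht, h'⟩⟩
  rw [this]
  exact ⟨hS.isCompact_biUnion fun s _ => hS'.isCompact_biUnion fun t _ =>
      (isCompact_isOpen_setMul_Theta s t).1,
    isOpen_biUnion fun s _ => isOpen_biUnion fun t _ => (isCompact_isOpen_setMul_Theta s t).2⟩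

theorem isCompact_isOpen_unitArrows [Finite V] [Finite A] :
    IsCompact (unitArrows T.InfPath) ∧ IsOpen (unitArrows T.InfPath) := by
  have : unitArrows T.InfPath = ⋃ v : V, Theta (T := T) (idem ⟨v, [], trivial⟩) ⟨v, [], trivial⟩ := by
    ext ⟨x, y, a⟩
    simp only [Set.mem_iUnion]
    constructor
    · rintro ⟨z, h⟩
      simp only [Quiver.Total.mk.injEq] at h
      obtain ⟨rfl, rfl, h⟩ := h
      obtain rfl := eq_of_heq h
      exact ⟨z.rng, z.mem_cylinder_initSeg 0, idem_maps (z.mem_cylinder_initSeg 0), rfl⟩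
    · rintro ⟨v, hv, hm, e⟩
      dsimp only at hv hm e
      obtain rfl := hm.unique (idem_maps hv)
      refine ⟨y, ?_⟩
      have hv' : v = y.rng := (mem_cylinder.1 hv).1.symm
      subst hv'
      rw [e]; rfl
  rw [this]
  exact ⟨isCompact_iUnion fun v => isCompact_Theta (idem ⟨v, [], trivial⟩),
    isOpen_iUnion fun v => isOpen_Theta _ _⟩

/-! ### The algebra structure -/

variable {R : Type*} [CommRing R]

theorem conv_mem [Finite A] {f g : Quiver.Total T.InfPath → R}
    (hf : f ∈ steinbergModule R T.InfPath) (hg : g ∈ steinbergModule R T.InfPath) :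
    conv f g ∈ steinbergModule R T.InfPath := by
  induction hf using Submodule.span_induction with
  | mem f hf =>
    induction hg using Submodule.span_induction with
    | mem g hg =>
      obtain ⟨B, h1, h2, h3, rfl⟩ := hf
      obtain ⟨D, h1', h2', h3', rfl⟩ := hg
      rw [conv_indicator h3']
      obtain ⟨h4, h5⟩ := isCompact_isOpen_setMul ⟨h2, h1⟩ ⟨h2', h1'⟩
      exact Submodule.subset_span ⟨_, h5, h4, h3.setMul h3', rfl⟩
    | zero => rw [conv_zero_right]; exact zero_mem _
    | add g g' hg hg' h h' =>
      rw [conv_add_right (sourceFinite_of_mem hg) (sourceFinite_of_mem hg')]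
      exact add_mem h h'
    | smul r g hg h =>
      rw [conv_smul_right r (sourceFinite_of_mem hg)]
      exact Submodule.smul_mem _ r h
  | zero => rw [conv_zero_left]; exact zero_mem _
  | add f f' _ _ h h' =>
    rw [conv_add_left (sourceFinite_of_mem hg)]
    exact add_mem h h'
  | smul r f _ h =>
    rw [conv_smul_left r (sourceFinite_of_mem hg)]
    exact Submodule.smul_mem _ r h

theorem conv_assoc_of_mem [Finite A] {f g k : Quiver.Total T.InfPath → R}
    (hf : f ∈ steinbergModule R T.InfPath) (hg : g ∈ steinbergModule R T.InfPath)
    (hk : k ∈ steinbergModule R T.InfPath) : conv (conv f g) k = conv f (conv g k) := by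
  have hk' := sourceFinite_of_mem hk
  induction hf using Submodule.span_induction with
  | mem f hf =>
    induction hg using Submodule.span_induction with
    | mem g hg =>
      induction hk using Submodule.span_induction with
      | mem k hk =>
        obtain ⟨B, h1, h2, h3, rfl⟩ := hf
        obtain ⟨C, h1', h2', h3', rfl⟩ := hg
        obtain ⟨D, h1'', h2'', h3'', rfl⟩ := hk
        rw [conv_indicator h3', conv_indicator h3'', conv_indicator h3'',
          conv_indicator (h3'.setMul h3''), setMul_assoc]
      | zero => simp
      | add k l hk hl h h' =>
        have a := sourceFinite_of_mem hk
        have b := sourceFinite_of_mem hl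
        have hg' : g ∈ steinbergModule R T.InfPath := Submodule.subset_span hg
        rw [conv_add_right a b, conv_add_right a b,
          conv_add_right (sourceFinite_of_mem (conv_mem hg' hk))
            (sourceFinite_of_mem (conv_mem hg' hl)), h a, h' b]
      | smul r k hk h =>
        have a := sourceFinite_of_mem hk
        have hg' : g ∈ steinbergModule R T.InfPath := Submodule.subset_span hg
        rw [conv_smul_right r a, conv_smul_right r a,
          conv_smul_right r (sourceFinite_of_mem (conv_mem hg' hk)), h a]
    | zero => simp
    | add g g' hg hg' h h' =>
      rw [conv_add_right (sourceFinite_of_mem hg) (sourceFinite_of_mem hg'),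
        conv_add_left hk', conv_add_left hk',
        conv_add_right (sourceFinite_of_mem (conv_mem hg hk))
          (sourceFinite_of_mem (conv_mem hg' hk)), h, h']
    | smul r g hg h =>
      rw [conv_smul_right r (sourceFinite_of_mem hg), conv_smul_left r hk',
        conv_smul_left r hk', conv_smul_right r (sourceFinite_of_mem (conv_mem hg hk)), h]
  | zero => simp
  | add f f' _ _ h h' =>
    rw [conv_add_left (sourceFinite_of_mem hg), conv_add_left hk', h, h',
      conv_add_left (sourceFinite_of_mem (conv_mem hg hk))]
  | smul r f _ h =>
    rw [conv_smul_left r (sourceFinite_of_mem hg), conv_smul_left r hk', h,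
      conv_smul_left r (sourceFinite_of_mem (conv_mem hg hk))]

theorem one_conv_of_mem {f : Quiver.Total T.InfPath → R}
    (hf : f ∈ steinbergModule R T.InfPath) :
    conv ((unitArrows T.InfPath).indicator 1) f = f := by
  induction hf using Submodule.span_induction with
  | mem f hf =>
    obtain ⟨B, -, -, h, rfl⟩ := hf
    rw [conv_indicator h, unitArrows_setMul]
  | zero => simp
  | add f f' hf hf' h h' =>
    rw [conv_add_right (sourceFinite_of_mem hf) (sourceFinite_of_mem hf'), h, h']
  | smul r f hf h => rw [conv_smul_right r (sourceFinite_of_mem hf), h]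

theorem unit_mem [Finite V] [Finite A] :
    (unitArrows T.InfPath).indicator 1 ∈ steinbergModule R T.InfPath :=
  Submodule.subset_span ⟨_, isCompact_isOpen_unitArrows.2, isCompact_isOpen_unitArrows.1,
    isBisection_unitArrows, rfl⟩

theorem conv_one_of_mem [Finite V] [Finite A] {f : Quiver.Total T.InfPath → R}
    (hf : f ∈ steinbergModule R T.InfPath) :
    conv f ((unitArrows T.InfPath).indicator 1) = f := by
  have h0 := sourceFinite_of_mem (unit_mem (T := T) (R := R))
  induction hf using Submodule.span_induction with
  | mem f hf =>
    obtain ⟨B, -, -, h, rfl⟩ := hf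
    rw [conv_indicator isBisection_unitArrows, setMul_unitArrows]
  | zero => simp
  | add f f' hf hf' h h' => rw [conv_add_left h0, h, h']
  | smul r f hf h => rw [conv_smul_left r h0, h]

noncomputable instance : AddCommGroup (SteinbergAlgebra R T.InfPath) :=
  inferInstanceAs (AddCommGroup ↥(steinbergModule R T.InfPath))

noncomputable instance : Module R (SteinbergAlgebra R T.InfPath) :=
  inferInstanceAs (Module R ↥(steinbergModule R T.InfPath))

/-- The Steinberg algebra of the groupoid of germs is a ring under convolution; its unit is the
characteristic function of the unit space. -/
noncomputable instance [Finite V] [Finite A] : Ring (SteinbergAlgebra R T.InfPath) :=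
  { (inferInstance : AddCommGroup (SteinbergAlgebra R T.InfPath)) with
    mul := fun f g => ⟨conv f.1 g.1, conv_mem f.2 g.2⟩
    one := ⟨(unitArrows T.InfPath).indicator 1, unit_mem⟩
    left_distrib := fun f g h => Subtype.ext
      (conv_add_right (sourceFinite_of_mem g.2) (sourceFinite_of_mem h.2))
    right_distrib := fun _ _ h => Subtype.ext (conv_add_left (sourceFinite_of_mem h.2))
    zero_mul := fun _ => Subtype.ext (conv_zero_left _)
    mul_zero := fun _ => Subtype.ext (conv_zero_right _)
    mul_assoc := fun f g h => Subtype.ext (conv_assoc_of_mem f.2 g.2 h.2)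
    one_mul := fun f => Subtype.ext (one_conv_of_mem f.2)
    mul_one := fun f => Subtype.ext (conv_one_of_mem f.2) }

noncomputable instance [Finite V] [Finite A] : Algebra R (SteinbergAlgebra R T.InfPath) :=
  Algebra.ofModule (fun r _ g => Subtype.ext (conv_smul_left r (sourceFinite_of_mem g.2)))
    (fun r _ g => Subtype.ext (conv_smul_right r (sourceFinite_of_mem g.2)))

theorem indicator_mem_of_isCompact_isOpen [Finite A] [T2Space (Quiver.Total T.InfPath)]
    {C : Set (Quiver.Total T.InfPath)} (hC : IsCompact C) (hC' : IsOpen C) :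
    C.indicator (1 : Quiver.Total T.InfPath → R) ∈ steinbergModule R T.InfPath := by
  classical
  obtain ⟨S, hS, rfl⟩ := (isCompact_open_iff_eq_finite_iUnion_of_isTopologicalBasis
    (fun s : T.Triple => Theta s s.β) isTopologicalBasis_Theta isCompact_Theta C).1 ⟨hC, hC'⟩
  clear hC hC'
  induction S, hS using Set.Finite.induction_on with
  | empty =>
    have : (∅ : Set (Quiver.Total T.InfPath)).indicator (1 : Quiver.Total T.InfPath → R) = 0 :=
      Set.indicator_empty _
    simp only [Set.mem_empty_iff_false, Set.iUnion_of_empty, Set.iUnion_empty, this]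
    exact zero_mem _
  | @insert s S _ hS ih =>
    have hK : IsCompact (⋃ t ∈ S, Theta t t.β) := hS.isCompact_biUnion fun t _ => isCompact_Theta t
    have hO : IsOpen (⋃ t ∈ S, Theta t t.β) := isOpen_biUnion fun t _ => isOpen_Theta t _
    rw [Set.biUnion_insert, Set.union_comm, ← Set.union_sdiff_self,
      Set.indicator_union_of_disjoint Set.disjoint_sdiff_right]
    refine add_mem ih (Submodule.subset_span ⟨_, (isOpen_Theta s _).sdiff hK.isClosed,
      (isCompact_Theta s).diff hO, ?_, rfl⟩)
    exact ⟨(Theta_isBisection s _).1.mono Set.sdiff_subset,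
      (Theta_isBisection s _).2.mono Set.sdiff_subset⟩

/-- If the groupoid is Hausdorff, then the Steinberg algebra consists of all locally constant
functions with compact support. -/
theorem mem_steinbergModule_iff [Finite A] [T2Space (Quiver.Total T.InfPath)]
    {f : Quiver.Total T.InfPath → R} :
    f ∈ steinbergModule R T.InfPath ↔ IsLocallyConstant f ∧ IsCompact (Function.support f) := by
  classical
  constructor
  · intro hf
    induction hf using Submodule.span_induction with
    | mem f hf =>
      obtain ⟨B, h1, h2, -, rfl⟩ := hf
      have hl : IsLocallyConstant (B.indicator (1 : Quiver.Total T.InfPath → R)) :=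
        by
        rw [← LocallyConstant.coe_charFn R ⟨h2.isClosed, h1⟩]
        exact LocallyConstant.isLocallyConstant _
      exact ⟨hl, h2.of_isClosed_subset (hl.isOpen_fiber 0).isClosed_compl Set.support_indicator_subset⟩
    | zero => exact ⟨IsLocallyConstant.const 0, by simp⟩
    | add f g _ _ hf hg =>
      refine ⟨hf.1.add hg.1, (hf.2.union hg.2).of_isClosed_subset
        ((hf.1.add hg.1).isOpen_fiber 0).isClosed_compl (Function.support_add f g)⟩
    | smul r f _ hf =>
      have hl : IsLocallyConstant (r • f) := hf.1.comp (r * ·)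
      exact ⟨hl, hf.2.of_isClosed_subset (hl.isOpen_fiber 0).isClosed_compl
        (Function.support_const_smul_subset r f)⟩
  · rintro ⟨hl, hK⟩
    have hfin : (f '' Function.support f).Finite := by
      let _ : TopologicalSpace R := ⊥
      have _ : DiscreteTopology R := ⟨rfl⟩
      exact isCompact_iff_finite.1 (hK.image hl.continuous)
    have : f = ∑ r ∈ hfin.toFinset, r • (f ⁻¹' {r}).indicator 1 := by
      funext c
      rw [Finset.sum_apply]
      by_cases hc : f c = 0
      · rw [hc, Finset.sum_eq_zero]
        intro r hr
        obtain ⟨d, hd, rfl⟩ := hfin.mem_toFinset.1 hr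
        have : c ∉ f ⁻¹' {f d} := fun h => hd (by rw [← hc]; exact h.symm)
        simp [this]
      · rw [Finset.sum_eq_single (f c)]
        · simp
        · intro r _ hr
          have : c ∉ f ⁻¹' {r} := fun h => hr h.symm
          simp [this]
        · exact fun h => absurd (hfin.mem_toFinset.2 ⟨c, hc, rfl⟩) h
    rw [this]
    refine Submodule.sum_mem _ fun r hr => Submodule.smul_mem _ r ?_
    obtain ⟨d, hd, rfl⟩ := hfin.mem_toFinset.1 hr
    refine indicator_mem_of_isCompact_isOpen (hK.of_isClosed_subset (hl.isClosed_fiber _) ?_)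
      (hl.isOpen_fiber _)
    intro c hc h0
    exact hd (by rw [← h0]; exact hc.symm)

variable (R) in
/-- The characteristic function of `Θ((α, g, β); Z(β))`, as an element of the Steinberg
algebra. -/
noncomputable def charTheta [Finite A] (s : T.Triple) : SteinbergAlgebra R T.InfPath :=
  ⟨(Theta s s.β).indicator 1, Submodule.subset_span
    ⟨_, isOpen_Theta s _, isCompact_Theta s, Theta_isBisection s _, rfl⟩⟩

/-! ### The algebra given by generators and relations -/

variable (T)

/-- The generators `p_x`, `s_a`, `s_a*`, `u_g`. -/
inductive Gen (T : GraphTriple G V A)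
  | p (x : V) : Gen T
  | s (a : A) : Gen T
  | sStar (a : A) : Gen T
  | u (g : G) : Gen T

variable (R)

/-- The generator `p_x` of the free algebra. -/
def fp (x : V) : FreeAlgebra R T.Gen := FreeAlgebra.ι R (Gen.p x)
/-- The generator `s_a` of the free algebra. -/
def fs (a : A) : FreeAlgebra R T.Gen := FreeAlgebra.ι R (Gen.s a)
/-- The generator `s_a*` of the free algebra. -/
def fsStar (a : A) : FreeAlgebra R T.Gen := FreeAlgebra.ι R (Gen.sStar a)
/-- The generator `u_g` of the free algebra. -/
def fu (g : G) : FreeAlgebra R T.Gen := FreeAlgebra.ι R (Gen.u g)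

open Classical in
/-- The defining relations. -/
inductive Rel [Fintype V] [Fintype A] : FreeAlgebra R T.Gen → FreeAlgebra R T.Gen → Prop
  /-- the `p_x` are pairwise orthogonal idempotents -/
  | p_mul_p (x y : V) : Rel (T.fp R x * T.fp R y) (if x = y then T.fp R x else 0)
  /-- the sum of the `p_x` is the unit -/
  | sum_p : Rel (∑ x : V, T.fp R x) 1
  /-- `s_a` has range `p_{r(a)}` and source `p_{s(a)}` -/
  | p_mul_s (a : A) : Rel (T.fp R (T.r a) * T.fs R a) (T.fs R a)
  | s_mul_p (a : A) : Rel (T.fs R a * T.fp R (T.s a)) (T.fs R a)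
  | sStar_mul_p (a : A) : Rel (T.fsStar R a * T.fp R (T.r a)) (T.fsStar R a)
  | p_mul_sStar (a : A) : Rel (T.fp R (T.s a) * T.fsStar R a) (T.fsStar R a)
  /-- the Cuntz-Krieger relations -/
  | sStar_mul_s (a b : A) :
      Rel (T.fsStar R a * T.fs R b) (if a = b then T.fp R (T.s a) else 0)
  | sum_s (x : V) :
      Rel (∑ a : A with T.r a = x, T.fs R a * T.fsStar R a) (T.fp R x)
  /-- `g ↦ u_g` is a unitary representation of the group -/
  | u_one : Rel (T.fu R 1) 1
  | u_mul (g h : G) : Rel (T.fu R (g * h)) (T.fu R g * T.fu R h)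
  /-- `u_g s_a = s_{g a} u_{φ(g, a)}`, and the adjoint of this relation -/
  | u_mul_s (g : G) (a : A) :
      Rel (T.fu R g * T.fs R a) (T.fs R (g • a) * T.fu R (T.φ g a))
  | sStar_mul_u (g : G) (a : A) :
      Rel (T.fsStar R a * T.fu R g⁻¹) (T.fu R (T.φ g a)⁻¹ * T.fsStar R (g • a))
  /-- `u_g p_x = p_{g x} u_g` -/
  | u_mul_p (g : G) (x : V) :
      Rel (T.fu R g * T.fp R x) (T.fp R (g • x) * T.fu R g)

variable [Fintype V] [Fintype A]

/-- The algebraic Exel-Pardo algebra of `(G, E, φ)` over `R`: the universal unital `R`-algebra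
with the generators and relations above. -/
abbrev ExelPardoAlgebra := RingQuot (T.Rel R)

/-- `p_x` -/
def p (x : V) : T.ExelPardoAlgebra R := RingQuot.mkAlgHom R (T.Rel R) (T.fp R x)
/-- `s_a` for an edge `a` -/
def sEdge (a : A) : T.ExelPardoAlgebra R := RingQuot.mkAlgHom R (T.Rel R) (T.fs R a)
/-- `s_a*` for an edge `a` -/
def sEdgeStar (a : A) : T.ExelPardoAlgebra R := RingQuot.mkAlgHom R (T.Rel R) (T.fsStar R a)
/-- `u_g` -/
def u (g : G) : T.ExelPardoAlgebra R := RingQuot.mkAlgHom R (T.Rel R) (T.fu R g)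

variable {T}

/-- `s_α = s_{a₁} ⋯ s_{aₙ}` for a path `α = a₁ ⋯ aₙ` with `n ≥ 1`, and `s_x = p_x` for a
vertex `x`. -/
def sPath (α : T.FinPath) : T.ExelPardoAlgebra R :=
  if α.edges.isEmpty then T.p R α.rng else (α.edges.map (T.sEdge R)).prod

/-- `s_α* = s_{aₙ}* ⋯ s_{a₁}*` for a path `α = a₁ ⋯ aₙ` with `n ≥ 1`, and `s_x* = p_x` for a
vertex `x`. -/
def sPathStar (α : T.FinPath) : T.ExelPardoAlgebra R :=
  if α.edges.isEmpty then T.p R α.rng else (α.edges.reverse.map (T.sEdgeStar R)).prod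

end GraphTriple
end ExelPardo

/-!
The elements `s_α u_g s_β*` of the Exel-Pardo algebra span it and multiply like the triples
`(α, g, β)`, as do the characteristic functions of the sets `Θ((α, g, β), Z(β))`; this gives a
homomorphism from the Exel-Pardo algebra to the Steinberg algebra. It is surjective because a
compact open bisection is a finite union of sets `Θ((α, g, β), Z(β))`, whose intersections inside
the bisection are again finite unions of such sets, so that inclusion-exclusion applies.

For injectivity, let `x` be an element of the Exel-Pardo algebra and `η` an infinite path with
initial segments `η|ₙ`. For large `n` the product `s_α u_g s_β* s_{η|ₙ}` depends only on the germ
of `(α, g, β)` at `η`, and it vanishes if `η` does not begin with `β`. Hence the image of `x`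
determines `x s_{η|ₙ}` for large `n`. If `x ≠ 0`, then by the relations `p_x = ∑ s_a s_a*` the
path `η` can be chosen, edge by edge, such that `x s_{η|ₙ} ≠ 0` for every `n`.
-/

namespace ExelPardo

open CategoryTheory Filter

section Groupoid

variable {X : Type*} [Groupoid X]

/-- The units at the points of `Y`, as a set of arrows. -/
def unitsOver (Y : Set X) : Set (Quiver.Total X) := (fun x => ⟨x, x, 𝟙 x⟩) '' Y

theorem unitsOver_univ : unitsOver Set.univ = unitArrows X := Set.image_univ

theorem setMul_unitsOver (B : Set (Quiver.Total X)) (Y : Set X) :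
    setMul B (unitsOver Y) = B ∩ Quiver.Total.left ⁻¹' Y := by
  ext ⟨x, y, a⟩
  constructor
  · rintro ⟨z, d, b, h, hb, ⟨w, hw, hunit⟩⟩
    simp only [Quiver.Total.mk.injEq] at hunit
    obtain ⟨rfl, rfl, hd⟩ := hunit
    obtain rfl := eq_of_heq hd
    dsimp only at b h hb
    rw [Category.id_comp] at h
    exact ⟨h ▸ hb, hw⟩
  · exact fun h => ⟨x, 𝟙 x, a, Category.id_comp a, h.1, x, h.2, rfl⟩

end Groupoid

variable {G V A : Type*} [Group G] [MulAction G V] [MulAction G A]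

namespace GraphTriple

variable {T : GraphTriple G V A}

/-! ### Products in the inverse semigroup -/

namespace Triple

theorem mul_eq_some_of_append {s t u : T.Triple} {ε : List A} (hrng : t.α.rng = s.β.rng)
    (hedges : t.α.edges = s.β.edges ++ ε) (hα_rng : u.α.rng = s.α.rng)
    (hα_edges : u.α.edges = s.α.edges ++ T.act s.g ε) (hg : u.g = T.coc s.g ε * t.g)
    (hβ : u.β = t.β) : s.mul t = some u := by
  have hprefix : s.β.IsPrefix t.α := ⟨hrng.symm, ε, hedges.symm⟩
  have hε : s.β.remainder t.α = ε := by simp [FinPath.remainder, hedges]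
  rw [Triple.mul, dif_pos hprefix]
  refine congrArg some (Triple.ext (FinPath.ext hα_rng.symm ?_) ?_ hβ.symm)
  · simp [FinPath.extend, hε, hα_edges]
  · simp [hε, hg]

theorem mul_eq_some_of_append' {s t u : T.Triple} {ε : List A} (hrng : s.β.rng = t.α.rng)
    (hedges : s.β.edges = t.α.edges ++ ε) (hβ_rng : u.β.rng = t.β.rng)
    (hβ_edges : u.β.edges = t.β.edges ++ T.act t.g⁻¹ ε) (hg : u.g = s.g * (T.coc t.g⁻¹ ε)⁻¹)
    (hα : u.α = s.α) : s.mul t = some u := by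
  rcases eq_or_ne ε [] with rfl | hne
  · exact mul_eq_some_of_append (ε := []) hrng.symm (by simpa using hedges.symm) (by rw [hα])
      (by simp [hα]) (by simpa using hg) (FinPath.ext hβ_rng (by simpa using hβ_edges))
  have hprefix : t.α.IsPrefix s.β := ⟨hrng.symm, ε, hedges.symm⟩
  have hnot : ¬ s.β.IsPrefix t.α := fun h => by
    have := h.2.length_le
    rw [hedges, List.length_append] at this
    exact hne (List.eq_nil_of_length_eq_zero (by omega))
  have hε : t.α.remainder s.β = ε := by simp [FinPath.remainder, hedges]
  rw [Triple.mul, dif_neg hnot, dif_pos hprefix]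
  refine congrArg some (Triple.ext hα.symm ?_ (FinPath.ext hβ_rng.symm ?_))
  · simp [hε, hg]
  · simp [FinPath.extend, hε, hβ_edges]

theorem mul_eq_some_of_eq {s t u : T.Triple} (h : s.β = t.α) (hα : u.α = s.α)
    (hg : u.g = s.g * t.g) (hβ : u.β = t.β) : s.mul t = some u :=
  mul_eq_some_of_append (ε := []) (by rw [h]) (by simp [h]) (by rw [hα]) (by simp [hα])
    (by simpa using hg) hβ

theorem mul_eq_none {s t : T.Triple} (h : ¬ s.β.IsPrefix t.α) (h' : ¬ t.α.IsPrefix s.β) :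
    s.mul t = none := by
  rw [Triple.mul, dif_neg h, dif_neg h']

theorem mul_eq_none_of_rng_ne {s t : T.Triple} (h : s.β.rng ≠ t.α.rng) : s.mul t = none :=
  mul_eq_none (fun h' => h h'.1) (fun h' => h h'.1.symm)

theorem idem_mul {γ : T.FinPath} {t : T.Triple} (h : γ.IsPrefix t.α) :
    (idem γ).mul t = some t :=
  mul_eq_some_of_append h.1.symm h.append_remainder.symm h.1.symm
    (by simp [idem, h.append_remainder]) (by simp [idem]) rfl

theorem mul_idem {γ : T.FinPath} {t : T.Triple} (h : γ.IsPrefix t.β) :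
    t.mul (idem γ) = some t :=
  mul_eq_some_of_append' h.1.symm h.append_remainder.symm h.1.symm
    (by simp [idem, h.append_remainder]) (by simp [idem]) rfl

end Triple

variable (T) in
/-- The vertex `x`, as a path of length zero. -/
@[simps] def vertexPath (x : V) : T.FinPath := ⟨x, [], trivial⟩

variable (T) in
/-- The edge `a`, as a path of length one. -/
@[simps] def edgePath (a : A) : T.FinPath := ⟨T.r a, [a], rfl, trivial⟩

@[simp] theorem edgePath_d (a : A) : (T.edgePath a).d = T.s a := rfl

theorem vertexPath_isPrefix {x : V} {γ : T.FinPath} (h : x = γ.rng) :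
    (T.vertexPath x).IsPrefix γ :=
  ⟨h, List.nil_prefix⟩

/-- The triple `(α, 1, d(α))` of the path `α`, which corresponds to `s_α`. -/
@[simps] def FinPath.toTriple (α : T.FinPath) : T.Triple :=
  ⟨α, 1, T.vertexPath α.d, (one_smul G _).symm⟩

variable (T) in
/-- The triple `(g x, g, x)`. The sum over all vertices `x` corresponds to `u_g`. -/
@[simps] def groupTriple (g : G) (x : V) : T.Triple :=
  ⟨T.vertexPath (g • x), g, T.vertexPath x, rfl⟩

theorem groupTriple_one (x : V) : T.groupTriple 1 x = idem (T.vertexPath x) :=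
  Triple.ext (FinPath.ext (one_smul G x) rfl) rfl rfl

/-- The action of the group on finite paths. -/
instance : SMul G T.FinPath :=
  ⟨fun g α => ⟨g • α.rng, T.act g α.edges, isPath_act g α.valid⟩⟩

@[simp] theorem FinPath.rng_smul (g : G) (α : T.FinPath) : (g • α).rng = g • α.rng := rfl

@[simp] theorem FinPath.edges_smul (g : G) (α : T.FinPath) :
    (g • α).edges = T.act g α.edges := rfl

theorem FinPath.d_smul (g : G) (α : T.FinPath) : (g • α).d = g • α.d :=
  endVertex_act g α.rng α.edges

namespace Triple

/-- The triple `(g α, φ(g, α) h, β)`, for `t = (α, h, β)`: the product of `u_g` and `t`. -/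
@[simps] def leftTranslate (g : G) (t : T.Triple) : T.Triple :=
  ⟨g • t.α, T.coc g t.α.edges * t.g, t.β, by
    rw [FinPath.d_smul, mul_smul, ← t.d_eq, coc_smul]⟩

/-- The triple `(α, h φ(g⁻¹, β)⁻¹, g⁻¹ β)`, for `t = (α, h, β)`: the product of `t` and `u_g`. -/
@[simps] def rightTranslate (t : T.Triple) (g : G) : T.Triple :=
  ⟨t.α, t.g * (T.coc g⁻¹ t.β.edges)⁻¹, g⁻¹ • t.β, by
    rw [FinPath.d_smul, mul_smul, t.d_eq, ← coc_smul g⁻¹ t.β.edges, inv_smul_smul]⟩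

theorem groupTriple_mul (g : G) (t : T.Triple) :
    (T.groupTriple g t.α.rng).mul t = some (t.leftTranslate g) :=
  mul_eq_some_of_append rfl rfl rfl rfl rfl rfl

theorem mul_groupTriple (t : T.Triple) (g : G) :
    t.mul (T.groupTriple g (g⁻¹ • t.β.rng)) = some (t.rightTranslate g) :=
  mul_eq_some_of_append' (smul_inv_smul g _).symm rfl rfl rfl rfl rfl

end Triple

section Algebra

variable {R : Type*} [CommRing R] [Fintype V] [Fintype A]

/-! ### The relations in the Exel-Pardo algebra -/

theorem mkAlgHom_eq_of_rel {x y : FreeAlgebra R T.Gen} (h : T.Rel R x y) :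
    RingQuot.mkAlgHom R (T.Rel R) x = RingQuot.mkAlgHom R (T.Rel R) y :=
  RingQuot.mkAlgHom_rel R h

theorem p_mul_p_self (x : V) : T.p R x * T.p R x = T.p R x := by
  simpa [p] using mkAlgHom_eq_of_rel (Rel.p_mul_p (T := T) (R := R) x x)

theorem p_mul_p_of_ne {x y : V} (h : x ≠ y) : T.p R x * T.p R y = 0 := by
  simpa [p, h] using mkAlgHom_eq_of_rel (Rel.p_mul_p (T := T) (R := R) x y)

variable (T R) in
theorem sum_p : ∑ x : V, T.p R x = 1 := by
  simpa [p] using mkAlgHom_eq_of_rel (Rel.sum_p (T := T) (R := R))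

theorem p_mul_sEdge (a : A) : T.p R (T.r a) * T.sEdge R a = T.sEdge R a := by
  simpa [p, sEdge] using mkAlgHom_eq_of_rel (Rel.p_mul_s (T := T) (R := R) a)

theorem sEdge_mul_p (a : A) : T.sEdge R a * T.p R (T.s a) = T.sEdge R a := by
  simpa [p, sEdge] using mkAlgHom_eq_of_rel (Rel.s_mul_p (T := T) (R := R) a)

theorem sEdgeStar_mul_p (a : A) : T.sEdgeStar R a * T.p R (T.r a) = T.sEdgeStar R a := by
  simpa [p, sEdgeStar] using mkAlgHom_eq_of_rel (Rel.sStar_mul_p (T := T) (R := R) a)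

theorem p_mul_sEdgeStar (a : A) : T.p R (T.s a) * T.sEdgeStar R a = T.sEdgeStar R a := by
  simpa [p, sEdgeStar] using mkAlgHom_eq_of_rel (Rel.p_mul_sStar (T := T) (R := R) a)

theorem sEdgeStar_mul_sEdge_self (a : A) :
    T.sEdgeStar R a * T.sEdge R a = T.p R (T.s a) := by
  simpa [p, sEdge, sEdgeStar] using mkAlgHom_eq_of_rel (Rel.sStar_mul_s (T := T) (R := R) a a)

theorem sEdgeStar_mul_sEdge_of_ne {a b : A} (h : a ≠ b) :
    T.sEdgeStar R a * T.sEdge R b = 0 := by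
  simpa [h, sEdge, sEdgeStar] using mkAlgHom_eq_of_rel (Rel.sStar_mul_s (T := T) (R := R) a b)

open Classical in
theorem sum_sEdge_mul_sEdgeStar (x : V) :
    ∑ a : A with T.r a = x, T.sEdge R a * T.sEdgeStar R a = T.p R x := by
  simpa [p, sEdge, sEdgeStar] using mkAlgHom_eq_of_rel (Rel.sum_s (T := T) (R := R) x)

theorem u_one : T.u R 1 = 1 := by
  simpa [u] using mkAlgHom_eq_of_rel (Rel.u_one (T := T) (R := R))

theorem u_mul (g h : G) : T.u R (g * h) = T.u R g * T.u R h := by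
  simpa [u] using mkAlgHom_eq_of_rel (Rel.u_mul (T := T) (R := R) g h)

theorem u_mul_sEdge (g : G) (a : A) :
    T.u R g * T.sEdge R a = T.sEdge R (g • a) * T.u R (T.φ g a) := by
  simpa [u, sEdge] using mkAlgHom_eq_of_rel (Rel.u_mul_s (T := T) (R := R) g a)

theorem sEdgeStar_mul_u_inv (g : G) (a : A) :
    T.sEdgeStar R a * T.u R g⁻¹ = T.u R (T.φ g a)⁻¹ * T.sEdgeStar R (g • a) := by
  simpa [u, sEdgeStar] using mkAlgHom_eq_of_rel (Rel.sStar_mul_u (T := T) (R := R) g a)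

theorem u_mul_p (g : G) (x : V) : T.u R g * T.p R x = T.p R (g • x) * T.u R g := by
  simpa [u, p] using mkAlgHom_eq_of_rel (Rel.u_mul_p (T := T) (R := R) g x)

/-! ### Products along words -/

variable (T R) in
/-- The product `s_{a₁} ⋯ s_{aₙ}` along a word of edges, with value `1` at the empty word. -/
def edgeProd (l : List A) : T.ExelPardoAlgebra R := (l.map (T.sEdge R)).prod

variable (T R) in
/-- The product `s_{aₙ}* ⋯ s_{a₁}*` along a word of edges, with value `1` at the empty word. -/
def edgeStarProd (l : List A) : T.ExelPardoAlgebra R := (l.reverse.map (T.sEdgeStar R)).prod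

@[simp] theorem edgeProd_nil : T.edgeProd R [] = 1 := rfl

@[simp] theorem edgeStarProd_nil : T.edgeStarProd R [] = 1 := rfl

theorem edgeProd_cons (a : A) (l : List A) :
    T.edgeProd R (a :: l) = T.sEdge R a * T.edgeProd R l := by simp [edgeProd]

theorem edgeStarProd_cons (a : A) (l : List A) :
    T.edgeStarProd R (a :: l) = T.edgeStarProd R l * T.sEdgeStar R a := by simp [edgeStarProd]

theorem edgeProd_append (l m : List A) :
    T.edgeProd R (l ++ m) = T.edgeProd R l * T.edgeProd R m := by simp [edgeProd]

theorem edgeStarProd_append (l m : List A) :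
    T.edgeStarProd R (l ++ m) = T.edgeStarProd R m * T.edgeStarProd R l := by
  simp [edgeStarProd]

theorem p_mul_edgeProd_cons (a : A) (l : List A) :
    T.p R (T.r a) * T.edgeProd R (a :: l) = T.edgeProd R (a :: l) := by
  rw [edgeProd_cons, ← mul_assoc, p_mul_sEdge]

theorem edgeStarProd_cons_mul_p (a : A) (l : List A) :
    T.edgeStarProd R (a :: l) * T.p R (T.r a) = T.edgeStarProd R (a :: l) := by
  rw [edgeStarProd_cons, mul_assoc, sEdgeStar_mul_p]

theorem p_mul_edgeProd_mul_p {x : V} {l : List A} (h : T.IsPath x l) :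
    T.p R x * T.edgeProd R l * T.p R (T.endVertex x l) = T.p R x * T.edgeProd R l := by
  induction l generalizing x with
  | nil => simp [endVertex, p_mul_p_self]
  | cons a l ih =>
    obtain ⟨rfl, h⟩ := h
    rw [p_mul_edgeProd_cons, edgeProd_cons, endVertex, ← sEdge_mul_p]
    simpa only [mul_assoc] using congrArg (T.sEdge R a * ·) (ih h)

theorem p_mul_edgeStarProd_mul_p {x : V} {l : List A} (h : T.IsPath x l) :
    T.p R (T.endVertex x l) * T.edgeStarProd R l * T.p R x = T.edgeStarProd R l * T.p R x := by
  induction l generalizing x with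
  | nil => simp [endVertex, p_mul_p_self]
  | cons a l ih =>
    obtain ⟨rfl, h⟩ := h
    rw [mul_assoc, edgeStarProd_cons_mul_p, edgeStarProd_cons, endVertex, ← p_mul_sEdgeStar]
    simpa only [mul_assoc] using congrArg (· * T.sEdgeStar R a) (ih h)

theorem u_mul_edgeProd (g : G) (l : List A) :
    T.u R g * T.edgeProd R l = T.edgeProd R (T.act g l) * T.u R (T.coc g l) := by
  induction l generalizing g with
  | nil => simp
  | cons a l ih =>
    rw [edgeProd_cons, ← mul_assoc, u_mul_sEdge, mul_assoc, ih, act, coc, edgeProd_cons, mul_assoc]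

theorem edgeStarProd_mul_u_inv (g : G) (l : List A) :
    T.edgeStarProd R l * T.u R g⁻¹ = T.u R (T.coc g l)⁻¹ * T.edgeStarProd R (T.act g l) := by
  induction l generalizing g with
  | nil => simp
  | cons a l ih =>
    rw [edgeStarProd_cons, mul_assoc, sEdgeStar_mul_u_inv, ← mul_assoc, ih, act, coc,
      edgeStarProd_cons, mul_assoc]

theorem edgeStarProd_mul_edgeProd {x : V} {l : List A} (h : T.IsPath x l) :
    T.edgeStarProd R l * T.p R x * T.edgeProd R l = T.p R (T.endVertex x l) := by
  induction l generalizing x with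
  | nil => simp [endVertex]
  | cons a l ih =>
    obtain ⟨rfl, h⟩ := h
    rw [edgeStarProd_cons_mul_p, edgeStarProd_cons, edgeProd_cons, endVertex, ← ih h,
      ← sEdgeStar_mul_sEdge_self]
    simp only [mul_assoc]

theorem edgeStarProd_mul_edgeProd_eq_zero {x : V} {l m : List A} (hl : T.IsPath x l)
    (hm : T.IsPath x m) (hlm : ¬ l <+: m) (hml : ¬ m <+: l) :
    T.edgeStarProd R l * T.p R x * T.edgeProd R m = 0 := by
  induction l generalizing x m with
  | nil => exact absurd m.nil_prefix hlm
  | cons a l ih =>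
    cases m with
    | nil => exact absurd (a :: l).nil_prefix hml
    | cons b m =>
      obtain ⟨rfl, hl⟩ := hl
      have hsplit : T.edgeStarProd R (a :: l) * T.p R (T.r a) * T.edgeProd R (b :: m) =
          T.edgeStarProd R l * (T.sEdgeStar R a * T.sEdge R b) * T.edgeProd R m := by
        rw [edgeStarProd_cons_mul_p, edgeStarProd_cons, edgeProd_cons]
        simp only [mul_assoc]
      rw [hsplit]
      rcases eq_or_ne a b with rfl | hab
      · rw [sEdgeStar_mul_sEdge_self]
        exact ih hl hm.2 (fun h => hlm (by simpa using h)) (fun h => hml (by simpa using h))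
      · rw [sEdgeStar_mul_sEdge_of_ne hab, mul_zero, zero_mul]

theorem sPath_eq (α : T.FinPath) : sPath R α = T.p R α.rng * T.edgeProd R α.edges := by
  obtain ⟨x, l, h⟩ := α
  cases l with
  | nil => simp [sPath]
  | cons a l =>
    obtain ⟨rfl, h⟩ := h
    exact (p_mul_edgeProd_cons a l).symm

theorem sPathStar_eq (α : T.FinPath) :
    sPathStar R α = T.edgeStarProd R α.edges * T.p R α.rng := by
  obtain ⟨x, l, h⟩ := α
  cases l with
  | nil => simp [sPathStar]
  | cons a l =>
    obtain ⟨rfl, h⟩ := h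
    exact (edgeStarProd_cons_mul_p a l).symm

theorem sPath_mul_p (α : T.FinPath) : sPath R α * T.p R α.d = sPath R α := by
  rw [sPath_eq, FinPath.d, p_mul_edgeProd_mul_p α.valid]

theorem p_mul_sPathStar (α : T.FinPath) : T.p R α.d * sPathStar R α = sPathStar R α := by
  rw [sPathStar_eq, FinPath.d, ← mul_assoc, p_mul_edgeStarProd_mul_p α.valid]

theorem sPath_extend (α : T.FinPath) {ε : List A} (h : T.IsPath α.d ε) :
    sPath R (α.extend ε h) = sPath R α * T.edgeProd R ε := by
  simp only [sPath_eq, FinPath.extend, edgeProd_append, mul_assoc]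

theorem sPathStar_extend (α : T.FinPath) {ε : List A} (h : T.IsPath α.d ε) :
    sPathStar R (α.extend ε h) = T.edgeStarProd R ε * sPathStar R α := by
  simp only [sPathStar_eq, FinPath.extend, edgeStarProd_append, mul_assoc]

theorem sPathStar_mul_sPath {β γ : T.FinPath} :
    sPathStar R β * sPath R γ =
      T.edgeStarProd R β.edges * (T.p R β.rng * T.p R γ.rng) * T.edgeProd R γ.edges := by
  simp only [sPathStar_eq, sPath_eq, mul_assoc]

theorem sPathStar_mul_sPath_of_isPrefix {β γ : T.FinPath} (h : β.IsPrefix γ) :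
    sPathStar R β * sPath R γ = T.p R β.d * T.edgeProd R (β.remainder γ) := by
  rw [sPathStar_mul_sPath, ← h.1, p_mul_p_self, ← h.append_remainder, edgeProd_append,
    ← mul_assoc, edgeStarProd_mul_edgeProd β.valid, FinPath.d]

theorem sPathStar_mul_sPath_of_isPrefix' {β γ : T.FinPath} (h : γ.IsPrefix β) :
    sPathStar R β * sPath R γ = T.edgeStarProd R (γ.remainder β) * T.p R γ.d := by
  rw [sPathStar_mul_sPath, ← h.1, p_mul_p_self, ← h.append_remainder, edgeStarProd_append,
    FinPath.d, ← edgeStarProd_mul_edgeProd γ.valid]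
  simp only [mul_assoc]

theorem sPathStar_mul_sPath_eq_zero {β γ : T.FinPath} (h : ¬ β.IsPrefix γ)
    (h' : ¬ γ.IsPrefix β) : sPathStar R β * sPath R γ = 0 := by
  rw [sPathStar_mul_sPath]
  rcases eq_or_ne β.rng γ.rng with hrng | hrng
  · rw [hrng, p_mul_p_self]
    exact edgeStarProd_mul_edgeProd_eq_zero (hrng ▸ β.valid) γ.valid (fun hp => h ⟨hrng, hp⟩)
      (fun hp => h' ⟨hrng.symm, hp⟩)
  · rw [p_mul_p_of_ne hrng, mul_zero, zero_mul]

/-! ### The spanning set of the elements `s_α u_g s_β*` -/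

variable (R) in
/-- The element `s_α u_g s_β*` of a triple `(α, g, β)`. -/
def monomial (t : T.Triple) : T.ExelPardoAlgebra R := sPath R t.α * T.u R t.g * sPathStar R t.β

theorem monomial_mul_eq (s t : T.Triple) :
    monomial R s * monomial R t = sPath R s.α * T.u R s.g * (sPathStar R s.β * sPath R t.α) *
      T.u R t.g * sPathStar R t.β := by
  simp only [monomial, mul_assoc]

theorem sPath_mul_u_mul_p (t : T.Triple) :
    sPath R t.α * T.u R t.g * T.p R t.β.d = sPath R t.α * T.u R t.g := by
  rw [mul_assoc, u_mul_p, ← t.d_eq, ← mul_assoc, sPath_mul_p]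

theorem p_mul_u_mul_sPathStar (t : T.Triple) :
    T.p R t.α.d * T.u R t.g * sPathStar R t.β = T.u R t.g * sPathStar R t.β := by
  rw [t.d_eq, ← u_mul_p, mul_assoc, p_mul_sPathStar]

theorem monomial_mul (s t : T.Triple) :
    monomial R s * monomial R t = (s.mul t).elim 0 (monomial R) := by
  rw [monomial_mul_eq, Triple.mul]
  split_ifs with h h'
  · rw [sPathStar_mul_sPath_of_isPrefix h, ← mul_assoc, sPath_mul_u_mul_p, mul_assoc (sPath R _),
      u_mul_edgeProd, Option.elim_some, monomial, sPath_extend, u_mul]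
    simp only [mul_assoc]
  · have hu := edgeStarProd_mul_u_inv (T := T) (R := R) t.g⁻¹ (t.α.remainder s.β)
    rw [inv_inv] at hu
    rw [sPathStar_mul_sPath_of_isPrefix' h', Option.elim_some, monomial, sPathStar_extend, u_mul]
    calc _ = sPath R s.α * T.u R s.g * T.edgeStarProd R (t.α.remainder s.β) *
          (T.p R t.α.d * T.u R t.g * sPathStar R t.β) := by simp only [mul_assoc]
      _ = sPath R s.α * T.u R s.g * (T.edgeStarProd R (t.α.remainder s.β) * T.u R t.g) *
          sPathStar R t.β := by rw [p_mul_u_mul_sPathStar]; simp only [mul_assoc]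
      _ = _ := by rw [hu]; simp only [mul_assoc]
  · rw [sPathStar_mul_sPath_eq_zero h h']
    simp

theorem monomial_toTriple (α : T.FinPath) : monomial R α.toTriple = sPath R α := by
  simp [monomial, u_one, sPathStar_eq, sPath_mul_p]

theorem monomial_star_toTriple (α : T.FinPath) : monomial R α.toTriple.star = sPathStar R α := by
  simp [monomial, Triple.star, u_one, sPath_eq, p_mul_sPathStar]

theorem sum_monomial_groupTriple (g : G) : ∑ x, monomial R (T.groupTriple g x) = T.u R g := by
  have h (x : V) : monomial R (T.groupTriple g x) = T.u R g * T.p R x := by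
    simp [monomial, sPath_eq, sPathStar_eq, ← u_mul_p, mul_assoc, p_mul_p_self]
  simp only [h, ← Finset.mul_sum, sum_p, mul_one]

theorem sPath_edgePath (a : A) : sPath R (T.edgePath a) = T.sEdge R a := by simp [sPath]

theorem sPathStar_edgePath (a : A) : sPathStar R (T.edgePath a) = T.sEdgeStar R a := by
  simp [sPathStar]

variable (T R) in
theorem span_range_monomial : Submodule.span R (Set.range (monomial R (T := T))) = ⊤ := by
  set M := Submodule.span R (Set.range (monomial R (T := T)))
  have monomial_mem (t : T.Triple) : monomial R t ∈ M := Submodule.subset_span ⟨t, rfl⟩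
  have sPath_mem (α : T.FinPath) : sPath R α ∈ M := monomial_toTriple (R := R) α ▸ monomial_mem _
  have sPathStar_mem (α : T.FinPath) : sPathStar R α ∈ M :=
    monomial_star_toTriple (R := R) α ▸ monomial_mem _
  have sEdge_mem (a : A) : T.sEdge R a ∈ M := by
    rw [← sPath_edgePath]; exact sPath_mem _
  have sEdgeStar_mem (a : A) : T.sEdgeStar R a ∈ M := by
    rw [← sPathStar_edgePath]; exact sPathStar_mem _
  have u_mem (g : G) : T.u R g ∈ M :=
    sum_monomial_groupTriple (T := T) (R := R) g ▸ sum_mem fun x _ => monomial_mem _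
  have mul_mem {x y : T.ExelPardoAlgebra R} (hx : x ∈ M) (hy : y ∈ M) : x * y ∈ M := by
    refine Submodule.mul_le.1 ?_ x hx y hy
    rw [Submodule.span_mul_span, Submodule.span_le]
    rintro _ ⟨_, ⟨s, rfl⟩, _, ⟨t, rfl⟩, rfl⟩
    simp only [monomial_mul]
    cases s.mul t with
    | none => exact zero_mem M
    | some u => exact monomial_mem u
  let S : Subalgebra R (T.ExelPardoAlgebra R) :=
    M.toSubalgebra (u_one (T := T) (R := R) ▸ u_mem 1) fun _ _ => mul_mem
  have generator_mem (c : T.Gen) :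
      RingQuot.mkAlgHom R (T.Rel R) (FreeAlgebra.ι R c) ∈ S := by
    cases c with
    | p x => exact sPath_mem (T.vertexPath x)
    | s a => exact sEdge_mem a
    | sStar a => exact sEdgeStar_mem a
    | u g => exact u_mem g
  have hS : S = ⊤ := by
    rw [eq_top_iff, ← (AlgHom.range_eq_top _).2 (RingQuot.mkAlgHom_surjective R (T.Rel R)),
      ← Algebra.map_top, ← FreeAlgebra.adjoin_range_ι, AlgHom.map_adjoin, Algebra.adjoin_le_iff]
    rintro _ ⟨_, ⟨c, rfl⟩, rfl⟩
    exact generator_mem c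
  exact congrArg Subalgebra.toSubmodule hS

end Algebra

section Steinberg

variable {R : Type*} [CommRing R]

/-! ### The generators in the Steinberg algebra -/

theorem mem_cylinder_vertexPath {η : T.InfPath} {x : V} :
    η ∈ cylinder (T.vertexPath x) ↔ η.rng = x :=
  mem_cylinder.trans ⟨fun h => h.1, fun h => ⟨h, rfl⟩⟩

theorem mem_cylinder_edgePath {η : T.InfPath} {a : A} :
    η ∈ cylinder (T.edgePath a) ↔ η.seq 0 = a :=
  mem_cylinder.trans
    ⟨fun h => (List.cons.inj h.2).1, fun h => ⟨congrArg T.r h, congrArg ([·]) h⟩⟩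

theorem germ_idem {γ : T.FinPath} {η : T.InfPath} (h : η ∈ cylinder γ) :
    germ (idem γ) (idem_maps h) = 𝟙 η := by
  refine (germ_eq_iff_lev _ _).2 ?_
  filter_upwards [lev_idem h, lev_idem (η.mem_cylinder_initSeg 0)] with n hγ hunit
  rw [hγ, hunit]

theorem Theta_idem (γ : T.FinPath) : Theta (idem γ) γ = unitsOver (cylinder γ) := by
  ext ⟨η, μ, a⟩
  constructor
  · rintro ⟨hη, hmaps, h⟩
    dsimp only at hη hmaps h
    obtain rfl := hmaps.unique (idem_maps hη)
    exact ⟨μ, hη, by rw [h, germ_idem hη]⟩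
  · rintro ⟨η, hη, h⟩
    rw [← h]
    exact ⟨hη, idem_maps hη, (germ_idem hη).symm⟩

variable (T R) in
/-- The inclusion of the Steinberg algebra into the module of all functions on the groupoid. -/
noncomputable def toFunction :
    SteinbergAlgebra R T.InfPath →ₗ[R] (Quiver.Total T.InfPath → R) :=
  (steinbergModule R T.InfPath).subtype

theorem toFunction_injective : Function.Injective (toFunction T R) := Subtype.val_injective

section FiniteEdges

variable [Finite A]

theorem toFunction_charTheta (s : T.Triple) :
    toFunction T R (charTheta R s) = (Theta s s.β).indicator 1 := rfl

theorem toFunction_sum_charTheta_idem {ι : Type*} (s : Finset ι) {γ : ι → T.FinPath}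
    (h : (s : Set ι).PairwiseDisjoint fun i => cylinder (γ i)) :
    toFunction T R (∑ i ∈ s, charTheta R (idem (γ i))) =
      (unitsOver (⋃ i ∈ s, cylinder (γ i))).indicator 1 := by
  have hdisj : (s : Set ι).PairwiseDisjoint fun i => unitsOver (cylinder (γ i)) :=
    fun i hi j hj hij => Set.disjoint_image_of_injective
      (fun _ _ h => congrArg Quiver.Total.left h) (h hi hj hij)
  have hunion : unitsOver (⋃ i ∈ s, cylinder (γ i)) = ⋃ i ∈ s, unitsOver (cylinder (γ i)) :=
    Set.image_iUnion₂ _ _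
  rw [hunion, Finset.indicator_biUnion s _ hdisj, map_sum]
  ext c
  simp only [Finset.sum_apply, toFunction_charTheta, ← Theta_idem]
  rfl

theorem charTheta_mul_of_some [Finite V] {s t u : T.Triple} (h : s.mul t = some u) :
    charTheta R s * charTheta R t = charTheta R u :=
  toFunction_injective <| (conv_indicator (Theta_isBisection t _)).trans <| by
    rw [setMul_Theta_of_some h, toFunction_charTheta]

theorem charTheta_mul_of_none [Finite V] {s t : T.Triple} (h : s.mul t = none) :
    charTheta R s * charTheta R t = 0 :=
  toFunction_injective <| (conv_indicator (Theta_isBisection t _)).trans <| by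
    rw [setMul_Theta_of_none h, Set.indicator_empty, map_zero]
    rfl

open Classical in
theorem vertex_mul_vertex [Finite V] (x y : V) :
    charTheta R (idem (T.vertexPath x)) * charTheta R (idem (T.vertexPath y)) =
      if x = y then charTheta R (idem (T.vertexPath x)) else 0 := by
  split_ifs with h
  · exact h ▸ charTheta_mul_of_some (Triple.idem_mul (FinPath.isPrefix_self _))
  · exact charTheta_mul_of_none (Triple.mul_eq_none_of_rng_ne h)

theorem star_toTriple_mul_toTriple [Finite V] (α : T.FinPath) :
    charTheta R α.toTriple.star * charTheta R α.toTriple =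
      charTheta R (idem (T.vertexPath α.d)) :=
  charTheta_mul_of_some
    (Triple.mul_eq_some_of_eq rfl rfl (by simp [idem, Triple.star]) rfl)

theorem toTriple_mul_star_toTriple [Finite V] (α : T.FinPath) :
    charTheta R α.toTriple * charTheta R α.toTriple.star = charTheta R (idem α) :=
  charTheta_mul_of_some
    (Triple.mul_eq_some_of_eq rfl rfl (by simp [idem, Triple.star]) rfl)

open Classical in
theorem edge_star_mul_edge [Finite V] (a b : A) :
    charTheta R (T.edgePath a).toTriple.star * charTheta R (T.edgePath b).toTriple =
      if a = b then charTheta R (idem (T.vertexPath (T.s a))) else 0 := by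
  have hprefix {a b : A} (h : (T.edgePath a).IsPrefix (T.edgePath b)) : a = b :=
    (List.cons.inj (h.2.eq_of_length rfl)).1
  split_ifs with h
  · exact h ▸ star_toTriple_mul_toTriple (T.edgePath a)
  · exact charTheta_mul_of_none
      (Triple.mul_eq_none (fun h' => h (hprefix h')) fun h' => h (hprefix h').symm)

variable [Fintype V]

variable (T R) in
/-- The image of `u_g` in the Steinberg algebra: the characteristic function of the set of all
germs `[g x, g, x; η]`, where `x` is the range of `η`. -/
noncomputable def charUnit (g : G) : SteinbergAlgebra R T.InfPath :=
  ∑ x : V, charTheta R (T.groupTriple g x)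

theorem sum_charTheta_idem_vertexPath :
    ∑ x : V, charTheta R (idem (T.vertexPath x)) = 1 := by
  refine toFunction_injective ?_
  rw [toFunction_sum_charTheta_idem]
  · have hcover : ⋃ x ∈ Finset.univ, cylinder (T.vertexPath x) = Set.univ :=
      Set.eq_univ_of_forall fun η => by simp [mem_cylinder_vertexPath]
    rw [hcover, unitsOver_univ]
    rfl
  · intro x _ y _ hxy
    refine Set.disjoint_left.2 fun η hx hy => hxy ?_
    rw [← mem_cylinder_vertexPath.1 hx, mem_cylinder_vertexPath.1 hy]

theorem charUnit_one : charUnit T R 1 = 1 := by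
  simp only [charUnit, groupTriple_one, sum_charTheta_idem_vertexPath]

theorem charUnit_mul_charTheta (g : G) (t : T.Triple) :
    charUnit T R g * charTheta R t = charTheta R (t.leftTranslate g) := by
  rw [charUnit, Finset.sum_mul, Finset.sum_eq_single t.α.rng]
  · exact charTheta_mul_of_some (t.groupTriple_mul g)
  · exact fun x _ hx => charTheta_mul_of_none (Triple.mul_eq_none_of_rng_ne hx)
  · simp

theorem charTheta_mul_charUnit (t : T.Triple) (g : G) :
    charTheta R t * charUnit T R g = charTheta R (t.rightTranslate g) := by
  rw [charUnit, Finset.mul_sum, Finset.sum_eq_single (g⁻¹ • t.β.rng)]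
  · exact charTheta_mul_of_some (t.mul_groupTriple g)
  · intro x _ hx
    refine charTheta_mul_of_none (Triple.mul_eq_none_of_rng_ne fun h => hx ?_)
    exact eq_inv_smul_iff.2 h.symm
  · simp

theorem charUnit_mul (g h : G) : charUnit T R (g * h) = charUnit T R g * charUnit T R h := by
  rw [charUnit, charUnit.eq_1 T R h, Finset.mul_sum]
  refine Finset.sum_congr rfl fun x _ => ?_
  rw [charUnit_mul_charTheta]
  exact congrArg _ (Triple.ext (FinPath.ext (mul_smul g h x) rfl) rfl rfl)

theorem charUnit_mul_edge (g : G) (a : A) :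
    charUnit T R g * charTheta R (T.edgePath a).toTriple =
      charTheta R (T.edgePath (g • a)).toTriple * charUnit T R (T.φ g a) := by
  rw [charUnit_mul_charTheta, charTheta_mul_charUnit]
  refine congrArg _ (Triple.ext (FinPath.ext (T.r_smul g a).symm rfl) (by simp [coc]) ?_)
  refine FinPath.ext ?_ rfl
  simp [T.s_smul, ← T.φ_smul g a]

theorem edge_star_mul_charUnit_inv (g : G) (a : A) :
    charTheta R (T.edgePath a).toTriple.star * charUnit T R g⁻¹ =
      charUnit T R (T.φ g a)⁻¹ * charTheta R (T.edgePath (g • a)).toTriple.star := by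
  rw [charUnit_mul_charTheta, charTheta_mul_charUnit]
  refine congrArg _ (Triple.ext (FinPath.ext ?_ rfl) ?_ (FinPath.ext ?_ ?_))
  · simp [Triple.star, T.s_smul, ← T.φ_smul g a]
  · simp [Triple.star, coc]
  · simp [Triple.star, T.r_smul]
  · simp [Triple.star, act]

theorem charUnit_mul_vertex (g : G) (x : V) :
    charUnit T R g * charTheta R (idem (T.vertexPath x)) =
      charTheta R (idem (T.vertexPath (g • x))) * charUnit T R g := by
  rw [charUnit_mul_charTheta, charTheta_mul_charUnit]
  exact congrArg _ (Triple.ext rfl (by simp [idem])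
    (FinPath.ext (inv_smul_smul g x).symm rfl))

variable (R) in
/-- The elements of the Steinberg algebra that correspond to the generators of the Exel-Pardo
algebra. -/
noncomputable def genImage : T.Gen → SteinbergAlgebra R T.InfPath
  | .p x => charTheta R (idem (T.vertexPath x))
  | .s a => charTheta R (T.edgePath a).toTriple
  | .sStar a => charTheta R (T.edgePath a).toTriple.star
  | .u g => charUnit T R g

end FiniteEdges

open Classical in
theorem sum_charTheta_idem_edgePath [Fintype A] (x : V) :
    ∑ a : A with T.r a = x, charTheta R (idem (T.edgePath a)) =
      charTheta R (idem (T.vertexPath x)) := by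
  refine toFunction_injective ?_
  rw [toFunction_sum_charTheta_idem, toFunction_charTheta]
  · refine congrArg (Set.indicator · 1) ((congrArg unitsOver ?_).trans (Theta_idem _).symm)
    ext η
    simp [mem_cylinder_edgePath, mem_cylinder_vertexPath, InfPath.rng]
  · intro a _ b _ hab
    refine Set.disjoint_left.2 fun η ha hb => hab ?_
    rw [← mem_cylinder_edgePath.1 ha, mem_cylinder_edgePath.1 hb]

variable [Fintype V] [Fintype A]

theorem lift_genImage_eq_of_rel {x y : FreeAlgebra R T.Gen} (h : T.Rel R x y) :
    FreeAlgebra.lift R (genImage R (T := T)) x = FreeAlgebra.lift R (genImage R (T := T)) y := by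
  have idem_mul {γ : T.FinPath} {t : T.Triple} (h : γ.IsPrefix t.α) :
      charTheta R (idem γ) * charTheta R t = charTheta R t :=
    charTheta_mul_of_some (Triple.idem_mul h)
  have mul_idem {γ : T.FinPath} {t : T.Triple} (h : γ.IsPrefix t.β) :
      charTheta R t * charTheta R (idem γ) = charTheta R t :=
    charTheta_mul_of_some (Triple.mul_idem h)
  cases h <;>
    simp only [fp, fs, fsStar, fu, map_mul, map_sum, map_one, map_zero,
      apply_ite (FreeAlgebra.lift R (genImage R)), FreeAlgebra.lift_ι_apply, genImage]
  case p_mul_p x y => exact vertex_mul_vertex x y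
  case sum_p => exact sum_charTheta_idem_vertexPath
  case p_mul_s a => exact idem_mul (vertexPath_isPrefix rfl)
  case s_mul_p a => exact mul_idem (vertexPath_isPrefix rfl)
  case sStar_mul_p a => exact mul_idem (vertexPath_isPrefix rfl)
  case p_mul_sStar a => exact idem_mul (vertexPath_isPrefix rfl)
  case sStar_mul_s a b => exact edge_star_mul_edge a b
  case sum_s x => simp only [toTriple_mul_star_toTriple, sum_charTheta_idem_edgePath]
  case u_one => exact charUnit_one
  case u_mul g h => exact charUnit_mul g h
  case u_mul_s g a => exact charUnit_mul_edge g a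
  case sStar_mul_u g a => exact edge_star_mul_charUnit_inv g a
  case u_mul_p g x => exact charUnit_mul_vertex g x

variable (T R) in
/-- The homomorphism from the Exel-Pardo algebra to the Steinberg algebra. -/
noncomputable def toSteinberg : T.ExelPardoAlgebra R →ₐ[R] SteinbergAlgebra R T.InfPath :=
  RingQuot.liftAlgHom R ⟨FreeAlgebra.lift R (genImage R), fun _ _ => lift_genImage_eq_of_rel⟩

theorem toSteinberg_p (x : V) :
    T.toSteinberg R (T.p R x) = charTheta R (idem (T.vertexPath x)) := by
  simp [toSteinberg, p, fp, genImage]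

theorem toSteinberg_sEdge (a : A) :
    T.toSteinberg R (T.sEdge R a) = charTheta R (T.edgePath a).toTriple := by
  simp [toSteinberg, sEdge, fs, genImage]

theorem toSteinberg_sEdgeStar (a : A) :
    T.toSteinberg R (T.sEdgeStar R a) = charTheta R (T.edgePath a).toTriple.star := by
  simp [toSteinberg, sEdgeStar, fsStar, genImage]

theorem toSteinberg_u (g : G) : T.toSteinberg R (T.u R g) = charUnit T R g := by
  simp [toSteinberg, u, fu, genImage]

theorem toSteinberg_sPath (α : T.FinPath) :
    T.toSteinberg R (sPath R α) = charTheta R α.toTriple := by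
  obtain ⟨x, l, hl⟩ := α
  rw [sPath_eq]
  induction l generalizing x with
  | nil => rw [edgeProd_nil, mul_one, toSteinberg_p]; rfl
  | cons a l ih =>
    obtain ⟨rfl, hl⟩ := hl
    rw [p_mul_edgeProd_cons, edgeProd_cons, ← sEdge_mul_p, mul_assoc, map_mul, ih _ hl,
      toSteinberg_sEdge]
    exact charTheta_mul_of_some (Triple.mul_eq_some_of_append (ε := l) rfl rfl rfl
      (by simp) (by simp) rfl)

theorem toSteinberg_sPathStar (α : T.FinPath) :
    T.toSteinberg R (sPathStar R α) = charTheta R α.toTriple.star := by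
  obtain ⟨x, l, hl⟩ := α
  rw [sPathStar_eq]
  induction l generalizing x with
  | nil =>
    rw [edgeStarProd_nil, one_mul, toSteinberg_p]
    exact congrArg _ (Triple.ext rfl inv_one.symm rfl)
  | cons a l ih =>
    obtain ⟨rfl, hl⟩ := hl
    rw [edgeStarProd_cons_mul_p, edgeStarProd_cons, ← p_mul_sEdgeStar, ← mul_assoc, map_mul,
      ih _ hl, toSteinberg_sEdgeStar]
    exact charTheta_mul_of_some (Triple.mul_eq_some_of_append' (ε := l) rfl rfl rfl
      (by simp [Triple.star]) (by simp [Triple.star]) rfl)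

theorem toSteinberg_monomial (t : T.Triple) :
    T.toSteinberg R (monomial R t) = charTheta R t := by
  rw [monomial, map_mul, map_mul, toSteinberg_sPath, toSteinberg_sPathStar, toSteinberg_u,
    charTheta_mul_charUnit]
  refine charTheta_mul_of_some (Triple.mul_eq_some_of_eq (FinPath.ext ?_ rfl) rfl ?_ rfl)
  · simp [Triple.star, t.d_eq]
  · simp [Triple.star]

end Steinberg

section Surjectivity

variable {R : Type*} [CommRing R]

/-! ### Surjectivity -/

variable (T R) in
/-- The linear span of the characteristic functions of the sets `Θ((α, g, β), Z(β))`. -/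
noncomputable def thetaSpan : Submodule R (Quiver.Total T.InfPath → R) :=
  Submodule.span R (Set.range fun s : T.Triple => (Theta s s.β).indicator 1)

theorem indicator_Theta_mem (s : T.Triple) : (Theta s s.β).indicator 1 ∈ thetaSpan T R :=
  Submodule.subset_span ⟨s, rfl⟩

theorem indicator_empty_mem {X : Type*} {M : Submodule R (X → R)} :
    (∅ : Set X).indicator 1 ∈ M :=
  Set.indicator_empty' (1 : X → R) ▸ zero_mem M

theorem indicator_union_mem {X : Type*} {M : Submodule R (X → R)} {B C : Set X}
    (hB : B.indicator 1 ∈ M) (hC : C.indicator 1 ∈ M) (hBC : (B ∩ C).indicator 1 ∈ M) :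
    (B ∪ C).indicator 1 ∈ M := by
  rw [eq_sub_of_add_eq (Set.indicator_union_add_inter (1 : X → R) B C)]
  exact sub_mem (add_mem hB hC) hBC

theorem Theta_inter_left_preimage (s : T.Triple) (γ : T.FinPath) :
    Theta s s.β ∩ Quiver.Total.left ⁻¹' cylinder γ =
      (s.mul (idem γ)).elim ∅ fun t => Theta t t.β := by
  rw [← setMul_unitsOver, ← Theta_idem]
  cases h : s.mul (idem γ) with
  | none => exact setMul_Theta_of_none h
  | some t => exact setMul_Theta_of_some h

theorem indicator_Theta_inter_mem (s : T.Triple) {S : Set T.FinPath} (hS : S.Finite) :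
    (Theta s s.β ∩ Quiver.Total.left ⁻¹' ⋃ γ ∈ S, cylinder γ).indicator 1 ∈ thetaSpan T R := by
  induction S, hS using Set.Finite.induction_on generalizing s with
  | empty => rw [Set.biUnion_empty, Set.preimage_empty, Set.inter_empty]; exact indicator_empty_mem
  | @insert γ S _ _ ih =>
    have hγ := Theta_inter_left_preimage s γ
    rw [Set.biUnion_insert, Set.preimage_union, Set.inter_union_distrib_left]
    refine indicator_union_mem ?_ (ih s) ?_
    · rw [hγ]
      cases s.mul (idem γ) with
      | none => exact indicator_empty_mem
      | some t => exact indicator_Theta_mem t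
    · rw [← Set.inter_inter_distrib_left, ← Set.inter_assoc, hγ]
      cases s.mul (idem γ) with
      | none => rw [Option.elim_none, Set.empty_inter]; exact indicator_empty_mem
      | some t => exact ih t

theorem image_left_Theta (s : T.Triple) :
    Quiver.Total.left '' Theta s s.β = cylinder s.β := by
  ext η
  constructor
  · rintro ⟨c, hc, rfl⟩
    exact hc.1
  · intro h
    obtain ⟨μ, hmaps⟩ := Triple.exists_maps h
    exact ⟨⟨η, μ, germ s hmaps⟩, ⟨h, hmaps, rfl⟩, rfl⟩

theorem indicator_biUnion_Theta_mem {S : Set T.Triple} (hS : S.Finite)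
    (h : Set.InjOn Quiver.Total.left (⋃ s ∈ S, Theta s s.β)) :
    (⋃ s ∈ S, Theta s s.β).indicator 1 ∈ thetaSpan T R := by
  induction S, hS using Set.Finite.induction_on with
  | empty => rw [Set.biUnion_empty]; exact indicator_empty_mem
  | @insert s S _ hS ih =>
    rw [Set.biUnion_insert] at h ⊢
    set C := ⋃ t ∈ S, Theta t t.β
    have himage : Quiver.Total.left '' C = ⋃ γ ∈ Triple.β '' S, cylinder γ := by
      simp only [C, Set.image_iUnion, image_left_Theta, Set.biUnion_image]
    have hinter : Theta s s.β ∩ C =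
        Theta s s.β ∩ Quiver.Total.left ⁻¹' (Quiver.Total.left '' C) := by
      refine subset_antisymm (Set.inter_subset_inter_right _ (Set.subset_preimage_image _ _)) ?_
      rintro c ⟨hc, d, hd, hdc⟩
      exact ⟨hc, h (Or.inr hd) (Or.inl hc) hdc ▸ hd⟩
    refine indicator_union_mem (indicator_Theta_mem s) (ih (h.mono Set.subset_union_right)) ?_
    rw [hinter, himage]
    exact indicator_Theta_inter_mem s (hS.image _)

theorem steinbergModule_le_thetaSpan [Finite A] :
    steinbergModule R T.InfPath ≤ thetaSpan T R := by
  refine Submodule.span_le.2 ?_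
  rintro _ ⟨B, hopen, hcompact, hB, rfl⟩
  obtain ⟨S, hS, rfl⟩ := (isCompact_open_iff_eq_finite_iUnion_of_isTopologicalBasis
    (fun s : T.Triple => Theta s s.β) isTopologicalBasis_Theta isCompact_Theta B).1
    ⟨hcompact, hopen⟩
  exact indicator_biUnion_Theta_mem hS hB.1

theorem toSteinberg_surjective [Fintype V] [Fintype A] :
    Function.Surjective (T.toSteinberg R) := by
  intro f
  have hspan : thetaSpan T R ≤
      LinearMap.range (toFunction T R ∘ₗ (T.toSteinberg R).toLinearMap) := by
    refine Submodule.span_le.2 ?_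
    rintro _ ⟨s, rfl⟩
    exact ⟨monomial R s, congrArg (toFunction T R) (toSteinberg_monomial s)⟩
  obtain ⟨x, hx⟩ := hspan (steinbergModule_le_thetaSpan f.2)
  exact ⟨x, toFunction_injective hx⟩

end Surjectivity

section Injectivity

variable {R : Type*} [CommRing R]

/-! ### Injectivity -/

theorem isPrefix_initSeg {γ : T.FinPath} {η : T.InfPath} (h : η ∈ cylinder γ) {n : ℕ}
    (hn : γ.edges.length ≤ n) : γ.IsPrefix (η.initSeg n) := by
  obtain ⟨hrng, htake⟩ := mem_cylinder.1 h
  refine ⟨hrng.symm, List.prefix_iff_eq_take.2 ?_⟩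
  rw [InfPath.initSeg, Stream'.take_take, min_eq_right hn, htake]

theorem mem_cylinder_of_isPrefix_initSeg {γ : T.FinPath} {η : T.InfPath} {n : ℕ}
    (h : γ.IsPrefix (η.initSeg n)) : η ∈ cylinder γ := by
  have hlen : γ.edges.length ≤ n := by simpa [InfPath.initSeg] using h.2.length_le
  refine mem_cylinder.2 ⟨h.1.symm, ?_⟩
  conv_rhs => rw [List.prefix_iff_eq_take.1 h.2]
  rw [InfPath.initSeg, Stream'.take_take, min_eq_right hlen]

theorem mem_cylinder_of_initSeg_isPrefix {γ : T.FinPath} {η : T.InfPath} {n : ℕ}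
    (hn : γ.edges.length ≤ n) (h : (η.initSeg n).IsPrefix γ) : η ∈ cylinder γ := by
  have hedges : (η.initSeg n).edges = γ.edges :=
    h.2.eq_of_length_le (by simpa [InfPath.initSeg] using hn)
  exact mem_cylinder_of_isPrefix_initSeg ⟨h.1.symm, hedges ▸ List.prefix_rfl⟩

/-- A form of König's lemma. -/
theorem exists_infPath_forall_initSeg {P : T.FinPath → Prop} {x : V} (hx : P (T.vertexPath x))
    (hP : ∀ γ, P γ → ∃ (a : A) (h : T.IsPath γ.d [a]), P (γ.extend [a] h)) :
    ∃ η : T.InfPath, ∀ n, P (η.initSeg n) := by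
  choose a ha hPa using fun γ : Subtype P => hP γ γ.2
  let path : ℕ → Subtype P := fun n =>
    (fun γ => ⟨(γ : T.FinPath).extend [a γ] (ha γ), hPa γ⟩)^[n] ⟨T.vertexPath x, hx⟩
  have path_succ (n : ℕ) :
      (path (n + 1) : T.FinPath) = (path n : T.FinPath).extend [a (path n)] (ha (path n)) :=
    congrArg Subtype.val (Function.iterate_succ_apply' _ n _)
  let η : T.InfPath := ⟨fun n => a (path n), fun n => by
    rw [(ha (path (n + 1))).1, path_succ, FinPath.d_extend]
    rfl⟩
  have initSeg_eq (n : ℕ) : η.initSeg n = path n := by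
    induction n with
    | zero => exact FinPath.ext (ha (path 0)).1 rfl
    | succ n ih =>
      rw [path_succ]
      have hrng : η.rng = (path n : T.FinPath).rng := congrArg FinPath.rng ih
      have hedges : η.seq.take n = (path n : T.FinPath).edges := congrArg FinPath.edges ih
      refine FinPath.ext hrng ((Stream'.take_succ' n).trans ?_)
      rw [hedges]
      rfl
  exact ⟨η, fun n => initSeg_eq n ▸ (path n).2⟩

variable (R) in
/-- The linear map that sends `c` to the part of `c` at the arrows with source `η`. -/
noncomputable def fiber (η : T.InfPath) :
    SteinbergAlgebra R T.InfPath →ₗ[R] (Quiver.Total T.InfPath →₀ R) where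
  toFun f := .ofSupportFinite ((Quiver.Total.left ⁻¹' {η}).indicator (toFunction T R f)) <| by
    rw [Set.support_indicator]
    exact sourceFinite_of_mem f.2 η
  map_add' f g := DFunLike.coe_injective (Set.indicator_add' _ _ _)
  map_smul' r f := DFunLike.coe_injective (Set.indicator_const_smul _ r _)

section FiniteEdges

variable [Finite A]

theorem coe_fiber_charTheta (η : T.InfPath) (t : T.Triple) :
    ⇑(fiber R η (charTheta R t)) =
      (Quiver.Total.left ⁻¹' {η} ∩ Theta t t.β).indicator (1 : Quiver.Total T.InfPath → R) :=
  Set.indicator_indicator _ _ _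

theorem fiber_charTheta_of_maps {t : T.Triple} {η μ : T.InfPath} (h : t.Maps η μ) :
    fiber R η (charTheta R t) = Finsupp.single ⟨η, μ, germ t h⟩ 1 := by
  have hmem : ⟨η, μ, germ t h⟩ ∈ Theta t t.β := ⟨h.mem_cylinder, h, rfl⟩
  have hsingleton : Quiver.Total.left ⁻¹' {η} ∩ Theta t t.β = {⟨η, μ, germ t h⟩} :=
    Set.eq_singleton_iff_unique_mem.2
      ⟨⟨rfl, hmem⟩, fun c hc => (Theta_isBisection t t.β).1 hc.2 hmem hc.1⟩
  refine DFunLike.coe_injective ?_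
  rw [coe_fiber_charTheta, hsingleton, Finsupp.set_indicator_singleton]
  rfl

theorem fiber_charTheta_of_notMem {t : T.Triple} {η : T.InfPath} (h : η ∉ cylinder t.β) :
    fiber R η (charTheta R t) = 0 := by
  have hempty : Quiver.Total.left ⁻¹' {η} ∩ Theta t t.β = ∅ :=
    Set.eq_empty_of_forall_notMem fun c hc => h (hc.1 ▸ hc.2.1)
  refine DFunLike.coe_injective ?_
  rw [coe_fiber_charTheta, hempty, Set.indicator_empty']
  rfl

end FiniteEdges

variable [Fintype V] [Fintype A]

variable (R) in
/-- The germ at infinity of the sequence `x s_{η|ₙ}`. -/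
def tail (η : T.InfPath) : T.ExelPardoAlgebra R →ₗ[R]
    Germ (atTop : Filter ℕ) (T.ExelPardoAlgebra R) where
  toFun x := ((fun n => x * sPath R (η.initSeg n) : ℕ → T.ExelPardoAlgebra R) : Germ atTop _)
  map_add' x y := congrArg _ (funext fun _ => add_mul x y _)
  map_smul' r x := congrArg _ (funext fun _ => smul_mul_assoc r x _)

variable (R) in
/-- The common value of `tail R η (monomial R t)` for all triples `t` with the germ `c` at the
source `η` of `c`. -/
def arrowTail (c : Quiver.Total T.InfPath) : Germ (atTop : Filter ℕ) (T.ExelPardoAlgebra R) :=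
  Quotient.lift (fun s : {s : T.Triple // s.Maps c.left c.right} =>
    ((fun n => T.p R c.right.rng * T.edgeProd R (s.1.lev c.left n).1 *
      T.u R (s.1.lev c.left n).2 : ℕ → T.ExelPardoAlgebra R) : Germ atTop _))
    (fun s t hst => Germ.coe_eq.2 <| by
      filter_upwards [(germRel_iff s.2 t.2).1 hst] with n hn
      rw [hn]) c.hom

theorem monomial_mul_sPath_of_isPrefix {t : T.Triple} {γ : T.FinPath} (h : t.β.IsPrefix γ) :
    monomial R t * sPath R γ = T.p R t.α.rng *
      T.edgeProd R (t.α.edges ++ T.act t.g (t.β.remainder γ)) *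
        T.u R (T.coc t.g (t.β.remainder γ)) :=
  calc monomial R t * sPath R γ
      = sPath R t.α * T.u R t.g * (sPathStar R t.β * sPath R γ) := by
        simp only [monomial, mul_assoc]
    _ = sPath R t.α * (T.u R t.g * T.edgeProd R (t.β.remainder γ)) := by
        rw [sPathStar_mul_sPath_of_isPrefix h, ← mul_assoc, sPath_mul_u_mul_p, mul_assoc]
    _ = _ := by
        rw [u_mul_edgeProd, sPath_eq, edgeProd_append]
        simp only [mul_assoc]

theorem tail_monomial_of_maps {t : T.Triple} {η μ : T.InfPath} (h : t.Maps η μ) :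
    tail R η (monomial R t) = arrowTail R ⟨η, μ, germ t h⟩ := by
  refine Germ.coe_eq.2 ?_
  filter_upwards [eventually_ge_atTop t.β.edges.length] with n hn
  have hremainder : t.β.remainder (η.initSeg n) =
      (η.seq.drop t.β.edges.length).take (n - t.β.edges.length) := by
    obtain ⟨m, rfl⟩ := Nat.exists_eq_add_of_le hn
    obtain ⟨ξ, -, hξ, -⟩ := h
    simp [FinPath.remainder, InfPath.initSeg, hξ, stream_take_append, Stream'.drop_append_stream]
  rw [monomial_mul_sPath_of_isPrefix (isPrefix_initSeg h.mem_cylinder hn), hremainder,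
    (mem_cylinder.1 h.mem_cylinder').1]
  rfl

theorem tail_monomial_of_notMem {t : T.Triple} {η : T.InfPath} (h : η ∉ cylinder t.β) :
    tail R η (monomial R t) = 0 := by
  refine Germ.coe_eq.2 ?_
  filter_upwards [eventually_ge_atTop t.β.edges.length] with n hn
  rw [monomial, mul_assoc, sPathStar_mul_sPath_eq_zero
    (fun h' => h (mem_cylinder_of_isPrefix_initSeg h'))
    (fun h' => h (mem_cylinder_of_initSeg_isPrefix hn h')), mul_zero]

theorem tail_eq (η : T.InfPath) (x : T.ExelPardoAlgebra R) :
    tail R η x = Finsupp.linearCombination R (arrowTail R) (fiber R η (T.toSteinberg R x)) := by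
  have heq : tail R η = Finsupp.linearCombination R (arrowTail R) ∘ₗ fiber R η ∘ₗ
      (T.toSteinberg R).toLinearMap := by
    refine LinearMap.ext_on_range (span_range_monomial T R) fun t => ?_
    simp only [LinearMap.comp_apply, AlgHom.toLinearMap_apply, toSteinberg_monomial]
    by_cases h : η ∈ cylinder t.β
    · obtain ⟨μ, hμ⟩ := Triple.exists_maps h
      rw [fiber_charTheta_of_maps hμ, Finsupp.linearCombination_single, one_smul,
        tail_monomial_of_maps hμ]
    · rw [fiber_charTheta_of_notMem h, map_zero, tail_monomial_of_notMem h]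
  exact LinearMap.congr_fun heq x

theorem exists_mul_sPath_extend_ne_zero {x : T.ExelPardoAlgebra R} {γ : T.FinPath}
    (hγ : x * sPath R γ ≠ 0) :
    ∃ (a : A) (h : T.IsPath γ.d [a]), x * sPath R (γ.extend [a] h) ≠ 0 := by
  classical
  contrapose! hγ
  rw [← sPath_mul_p, ← sum_sEdge_mul_sEdgeStar, ← mul_assoc, Finset.mul_sum]
  refine Finset.sum_eq_zero fun a ha => ?_
  have hpath : T.IsPath γ.d [a] := ⟨(Finset.mem_filter.1 ha).2, trivial⟩
  have hzero := hγ a hpath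
  rw [sPath_extend γ hpath, edgeProd_cons, edgeProd_nil, mul_one, ← mul_assoc] at hzero
  rw [← mul_assoc, hzero, zero_mul]

theorem exists_infPath_mul_sPath_ne_zero {x : T.ExelPardoAlgebra R} (hx : x ≠ 0) :
    ∃ η : T.InfPath, ∀ n, x * sPath R (η.initSeg n) ≠ 0 := by
  obtain ⟨v, hv⟩ : ∃ v, x * sPath R (T.vertexPath v) ≠ 0 := by
    by_contra! h
    refine hx ?_
    rw [← mul_one x, ← sum_p T R, Finset.mul_sum]
    exact Finset.sum_eq_zero fun v _ => h v
  exact exists_infPath_forall_initSeg hv fun _ => exists_mul_sPath_extend_ne_zero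

theorem toSteinberg_injective : Function.Injective (T.toSteinberg R) := by
  refine (injective_iff_map_eq_zero _).2 fun x hx => ?_
  by_contra hne
  obtain ⟨η, hη⟩ := exists_infPath_mul_sPath_ne_zero hne
  have htail : tail R η x = 0 := by rw [tail_eq, hx, map_zero, map_zero]
  obtain ⟨n, hn⟩ := (Germ.coe_eq.1 htail).exists
  exact hη n hn

end Injectivity

end GraphTriple

end ExelPardo

theorem theorem6p4 {G V A : Type*} [Group G] [MulAction G V] [MulAction G A] [Fintype V]
    [Fintype A] (T : ExelPardo.GraphTriple G V A) (R : Type*) [CommRing R] :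
    ∃ Φ : ExelPardo.SteinbergAlgebra R T.InfPath ≃ₐ[R] T.ExelPardoAlgebra R,
      ∀ s : T.Triple,
        Φ (ExelPardo.GraphTriple.charTheta R s) =
          ExelPardo.GraphTriple.sPath R s.α * T.u R s.g * ExelPardo.GraphTriple.sPathStar R s.β := by
  refine ⟨(AlgEquiv.ofBijective (T.toSteinberg R) ⟨ExelPardo.GraphTriple.toSteinberg_injective,
    ExelPardo.GraphTriple.toSteinberg_surjective⟩).symm, fun s => ?_⟩
  rw [AlgEquiv.symm_apply_eq]
  exact (ExelPardo.GraphTriple.toSteinberg_monomial s).symm
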